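/- Let $A,Q,A_0^1,\dots,A_0^r\in\mathbb{R}^{n\times n}$, $B,L,B_0^1,\dots,B_0^r\in\mathbb{R}^{n\times m}$ and $R\in\mathbb{R}^{m\times m}$ satisfy $$R\succ 0,\qquad \begin{bmatrix} Q & L\\ L^{\mathsf T} & R\end{bmatrix}\succeq 0 .$$ For symmetric $X\in\mathbb{R}^{n\times n}$ put $\Pi_{11}(X)=\sum_{i=1}^r (A_0^i)^{\mathsf T}XA_0^i$, $\Pi_{12}(X)=\sum_{i=1}^r (A_0^i)^{\mathsf T}XB_0^i$, $\Pi_{22}(X)=\sum_{i=1}^r (B_0^i)^{\mathsf T}XB_0^i$, and $L_c(X)=L+\Pi_{12}(X)$, $R_c(X)=R+\Pi_{22}(X)$, $Q_c(X)=Q+\Pi_{11}(X)$, $$A_c(X)=A-BR_c(X)^{-1}L_c(X)^{\mathsf T},\quad G_c(X)=BR_c(X)^{-1}B^{\mathsf T},\quad H_c(X)=Q_c(X)-L_c(X)R_c(X)^{-1}L_c(X)^{\mathsf T},$$ $$\mathscr R(X)=A^{\mathsf T}X+XA+Q+\Pi_{11}(X)-[XB+L_c(X)]\,R_c(X)^{-1}\,[XB+L_c(X)]^{\mathsf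 T}.$$ Call a real square matrix stable if all its eigenvalues have negative real part. Assume the following. 1. There is $F\in\mathbb{R}^{m\times n}$ such that the equation $\dot S=(A+BF)S+S(A+BF)^{\mathsf T}+\sum_{i=1}^r(A_0^i+B_0^iF)S(A_0^i+B_0^iF)^{\mathsf T}$ on symmetric matrices $S(t)$ is exponentially stable. 2. For a matrix $C\in\mathbb{R}^{p\times n}$ with $C^{\mathsf T}C=Q-LR^{-1}L^{\mathsf T}$, and with $\widetilde A=A-BR^{-1}L^{\mathsf T}$, $\widetilde A_0^i=A_0^i-B_0^iR^{-1}L^{\mathsf T}$, there is $K\in\mathbb{R}^{n\times p}$ such that the equation $\dot S=(\widetilde A+KC)S+S(\widetilde A+KC)^{\mathsf T}+\sum_{i=1}^r\widetilde A_0^iS(\widetilde A_0^i)^{\mathsf T}$ on symmetric matrices $S(t)$ is exponentially stable. 3. $\mathcal N(Q-LR^{-1}L^{\mathsf T})\subseteq\mathcal N(L^{\mathsf T})\cap\bigcap_{i=1}^r\mathcal N(A_0^i)$, where $\mathcal N$ denotes the null space. 4. $(A,B)$ is stabilizable and $(Q-LR^{-1}L^{\mathsf T},A)$ is detectable, i.e.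 $A+BF'$ and $A+K'(Q-LR^{-1}L^{\mathsf T})$ are stable for some real matrices $F'$ and $K'$. Then the stochastic algebraic Riccati equation $\mathscr R(X)=0$ has a unique positive semidefinite solution $X_*$. Let moreover $X_0\in\mathbb{R}^{n\times n}$ be symmetric with $X_0\succeq X_*$, $A_c(X_0)-G_c(X_0)X_0$ stable and $\mathscr R(X_0)\preceq 0$. Then there is exactly one sequence $X_0,X_1,X_2,\dots$ of FPSDA iterates starting from $X_0$, i.e. one sequence such that for every $k\ge 0$ the matrix $X_{k+1}$ is a stabilizing solution $X$ of $$A_k^{\mathsf T}X+XA_k-XG_kX+H_k=0,\qquad A_k=A_c(X_k),\ G_k=G_c(X_k),\ H_k=H_c(X_k),$$ meaning that $X=X_{k+1}$ satisfies this equation and $A_k-G_kX_{k+1}$ is stable. This sequence satisfies: (i) $X_0\succeq X_1\succeq\cdots\succeq X_k\succeq X_*$ and $\mathscr R(X_k)\preceq 0$ for every $k\ge 0$; (ii) $\lim_{k\to\infty}X_k=X_*$. -/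

import Mathlib

open scoped Matrix
open Filter Topology

namespace SCARE

/-! ### Stability notions -/

/-- A real square matrix is stable if all its (complex) eigenvalues have negative real part. -/
def IsStable {n : ℕ} (M : Matrix (Fin n) (Fin n) ℝ) : Prop :=
  ∀ z ∈ spectrum ℂ (M.map (algebraMap ℝ ℂ)), z.re < 0

/-- `(A, B)` is stabilizable: `A + B F` is stable for some feedback matrix `F`. -/
def IsStabilizable {n m : ℕ} (A : Matrix (Fin n) (Fin n) ℝ) (B : Matrix (Fin n) (Fin m) ℝ) :
    Prop :=
  ∃ F : Matrix (Fin m) (Fin n) ℝ, IsStable (A + B * F)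

/-- `(C, A)` is detectable: `A + K C` is stable for some output injection matrix `K`. -/
def IsDetectable {n p : ℕ} (C : Matrix (Fin p) (Fin n) ℝ) (A : Matrix (Fin n) (Fin n) ℝ) :
    Prop :=
  ∃ K : Matrix (Fin n) (Fin p) ℝ, IsStable (A + K * C)

/-- The generalized Lyapunov operator `S ↦ M S + S Mᵀ + ∑ i, N i S (N i)ᵀ`. -/
def lyapOp {n r : ℕ} (M : Matrix (Fin n) (Fin n) ℝ) (N : Fin r → Matrix (Fin n) (Fin n) ℝ)
    (S : Matrix (Fin n) (Fin n) ℝ) : Matrix (Fin n) (Fin n) ℝ :=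
  M * S + S * Mᵀ + ∑ i, N i * S * (N i)ᵀ

section
open scoped Matrix.Norms.Frobenius

/-- Exponential stability of the linear matrix differential equation
`dS/dt = M S + S Mᵀ + ∑ i, N i S (N i)ᵀ` on symmetric matrices: there are `β, α > 0` such that
`‖S(t)‖ ≤ β exp(-α (t - t₀)) ‖S(t₀)‖` for all solutions `S` and all `t ≥ t₀`
(Frobenius norm; the derivative is taken entry by entry). -/
def IsExpStable {n r : ℕ} (M : Matrix (Fin n) (Fin n) ℝ)
    (N : Fin r → Matrix (Fin n) (Fin n) ℝ) : Prop :=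
  ∃ β : ℝ, 0 < β ∧ ∃ α : ℝ, 0 < α ∧ ∀ S : ℝ → Matrix (Fin n) (Fin n) ℝ,
    (∀ t, (S t).IsSymm) →
    (∀ t i j, HasDerivAt (fun s => S s i j) (lyapOp M N (S t) i j) t) →
    ∀ t₀ t, t₀ ≤ t → ‖S t‖ ≤ β * Real.exp (-α * (t - t₀)) * ‖S t₀‖

end

/-! ### The equation and its coefficients -/

/-- The coefficient matrices of the equation (pure data). -/
structure Data (n m r : ℕ) where
  A : Matrix (Fin n) (Fin n) ℝ
  B : Matrix (Fin n) (Fin m) ℝ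
  Q : Matrix (Fin n) (Fin n) ℝ
  L : Matrix (Fin n) (Fin m) ℝ
  R : Matrix (Fin m) (Fin m) ℝ
  A₀ : Fin r → Matrix (Fin n) (Fin n) ℝ
  B₀ : Fin r → Matrix (Fin n) (Fin m) ℝ

namespace Data

variable {n m r : ℕ} (D : Data n m r)

/-- `Π₁₁(X) = ∑ i, (A₀ i)ᵀ X (A₀ i)`. -/
def Pi11 (X : Matrix (Fin n) (Fin n) ℝ) : Matrix (Fin n) (Fin n) ℝ :=
  ∑ i, (D.A₀ i)ᵀ * X * D.A₀ i

/-- `Π₁₂(X) = ∑ i, (A₀ i)ᵀ X (B₀ i)`. -/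
def Pi12 (X : Matrix (Fin n) (Fin n) ℝ) : Matrix (Fin n) (Fin m) ℝ :=
  ∑ i, (D.A₀ i)ᵀ * X * D.B₀ i

/-- `Π₂₂(X) = ∑ i, (B₀ i)ᵀ X (B₀ i)`. -/
def Pi22 (X : Matrix (Fin n) (Fin n) ℝ) : Matrix (Fin m) (Fin m) ℝ :=
  ∑ i, (D.B₀ i)ᵀ * X * D.B₀ i

/-- `L_c(X) = L + Π₁₂(X)`. -/
def Lc (X : Matrix (Fin n) (Fin n) ℝ) : Matrix (Fin n) (Fin m) ℝ := D.L + D.Pi12 X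

/-- `R_c(X) = R + Π₂₂(X)`. -/
def Rc (X : Matrix (Fin n) (Fin n) ℝ) : Matrix (Fin m) (Fin m) ℝ := D.R + D.Pi22 X

/-- `Q_c(X) = Q + Π₁₁(X)`. -/
def Qc (X : Matrix (Fin n) (Fin n) ℝ) : Matrix (Fin n) (Fin n) ℝ := D.Q + D.Pi11 X

/-- `A_c(X) = A - B R_c(X)⁻¹ L_c(X)ᵀ`. -/
noncomputable def Ac (X : Matrix (Fin n) (Fin n) ℝ) : Matrix (Fin n) (Fin n) ℝ :=
  D.A - D.B * (D.Rc X)⁻¹ * (D.Lc X)ᵀ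

/-- `G_c(X) = B R_c(X)⁻¹ Bᵀ`. -/
noncomputable def Gc (X : Matrix (Fin n) (Fin n) ℝ) : Matrix (Fin n) (Fin n) ℝ :=
  D.B * (D.Rc X)⁻¹ * D.Bᵀ

/-- `H_c(X) = Q_c(X) - L_c(X) R_c(X)⁻¹ L_c(X)ᵀ`. -/
noncomputable def Hc (X : Matrix (Fin n) (Fin n) ℝ) : Matrix (Fin n) (Fin n) ℝ :=
  D.Qc X - D.Lc X * (D.Rc X)⁻¹ * (D.Lc X)ᵀ

/-- The left-hand side `ℛ(X)` of the stochastic Riccati equation. -/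
noncomputable def residual (X : Matrix (Fin n) (Fin n) ℝ) : Matrix (Fin n) (Fin n) ℝ :=
  D.Aᵀ * X + X * D.A + D.Q + D.Pi11 X
    - (X * D.B + D.L + D.Pi12 X) * (D.R + D.Pi22 X)⁻¹ * (X * D.B + D.L + D.Pi12 X)ᵀ

/-- `X` is a positive semidefinite solution of the stochastic Riccati equation `ℛ(X) = 0`. -/
def IsPSDSolution (X : Matrix (Fin n) (Fin n) ℝ) : Prop :=
  X.PosSemidef ∧ D.residual X = 0

/-- Stabilizability of `({A, A₀ i}, {B, B₀ i})`: some feedback `F` makes the equation with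
coefficients `A + B F`, `A₀ i + B₀ i F` exponentially stable. -/
def StochStabilizable : Prop :=
  ∃ F : Matrix (Fin m) (Fin n) ℝ, IsExpStable (D.A + D.B * F) (fun i => D.A₀ i + D.B₀ i * F)

/-- Detectability of `(C, {Ã, Ã₀ i})` with `Ã = A - B R⁻¹ Lᵀ` and `Ã₀ i = A₀ i - B₀ i R⁻¹ Lᵀ`:
some output injection `K` makes the equation with coefficients `Ã + K C`, `Ã₀ i`
exponentially stable. -/
def StochDetectable {p : ℕ} (C : Matrix (Fin p) (Fin n) ℝ) : Prop :=
  ∃ K : Matrix (Fin n) (Fin p) ℝ,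
    IsExpStable (D.A - D.B * D.R⁻¹ * D.Lᵀ + K * C) (fun i => D.A₀ i - D.B₀ i * D.R⁻¹ * D.Lᵀ)

end Data

/-! ### The iteration -/

/-- `X` is a stabilizing solution of the Riccati equation `Aᵀ X + X A - X G X + H = 0`. -/
def IsStabilizingSolution {n : ℕ} (A G H X : Matrix (Fin n) (Fin n) ℝ) : Prop :=
  Aᵀ * X + X * A - X * G * X + H = 0 ∧ IsStable (A - G * X)

/-- `X` is a sequence generated by FPSDA from `X₀` with exact inner solves: `X (k + 1)` is a
stabilizing solution of the Riccati equation whose coefficients are frozen at `X k`. -/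
def IsFPSDA {n m r : ℕ} (D : Data n m r) (X₀ : Matrix (Fin n) (Fin n) ℝ)
    (X : ℕ → Matrix (Fin n) (Fin n) ℝ) : Prop :=
  X 0 = X₀ ∧
    ∀ k, IsStabilizingSolution (D.Ac (X k)) (D.Gc (X k)) (D.Hc (X k)) (X (k + 1))

end SCARE

/-!
The argument rests on one notion of stability, the *Lyapunov certificate* (`HasCertificate`): a
positive definite `P` with `lyapOp M N P` negative definite. Under a certificate the operator
satisfies a maximum principle (`HasCertificate.posSemidef_of_lyapOp`): if `lyapOp M N X ⪯ 0` then
`X ⪰ 0`, since otherwise some `X + t P` would be positive semidefinite with a kernel vector on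
which the quadratic form of `lyapOp M N (X + t P)` has the wrong sign. Without a certificate there
is a positive semidefinite eigenvector for an eigenvalue `lam ≥ 0`
(`exists_eigenvector_of_not_hasCertificate`). These two facts replace semigroups and integral
formulas: exponential stability gives a certificate because `exp (lam t) S` would not decay, and a
matrix is stable exactly when it has a certificate without noise terms.

For a feedback `F`, `closedLoop X F` is the residual of the Lyapunov equation for the value of `F`;
completing the square, it exceeds `residual X` by a positive semidefinite term that vanishes at
`F = gain X`. Detectability shows that a feedback with a positive semidefinite supersolution is
stabilizing (`IsRegular.isStableLoop`). Consequently positive semidefinite supersolutions dominate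
subsolutions (`IsRegular.posSemidef_sub`), which gives uniqueness, and a supersolution of least
trace is a solution, because a Newton step would decrease it (`IsRegular.exists_isPSDSolution`).

One step of the iteration from `W` solves the Riccati equation of the deterministic problem
`frozen W`, whose weight contains the noise contribution of `W`. The null space condition transfers
detectability to this problem (`isRegular_frozen`), so the same theory provides its positive
semidefinite solution, which is the only stabilizing one by Sylvester's theorem. The frozen residual
is monotone in `W`, and at `X = W` it is the stochastic residual. Comparison then shows that
the iterates decrease, dominate the solution `Xs` and remain supersolutions (`step_invariant`). Their
limit solves the stochastic equation by continuity and equals `Xs` by uniqueness.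
-/

namespace SCARE

/-! ### Positive semidefinite real matrices -/

section Prelim

variable {n m : ℕ}

lemma isSymm_of_posSemidef {X : Matrix (Fin n) (Fin n) ℝ} (h : X.PosSemidef) : Xᵀ = X := by
  simpa using h.isHermitian.eq

lemma isSymm_of_posDef {X : Matrix (Fin n) (Fin n) ℝ} (h : X.PosDef) : Xᵀ = X :=
  isSymm_of_posSemidef h.posSemidef

lemma posSemidef_iff_real {X : Matrix (Fin n) (Fin n) ℝ} :
    X.PosSemidef ↔ Xᵀ = X ∧ ∀ x, 0 ≤ x ⬝ᵥ (X *ᵥ x) := by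
  rw [Matrix.posSemidef_iff_dotProduct_mulVec]
  simp [Matrix.IsHermitian]

lemma posDef_iff_real {X : Matrix (Fin n) (Fin n) ℝ} :
    X.PosDef ↔ Xᵀ = X ∧ ∀ x, x ≠ 0 → 0 < x ⬝ᵥ (X *ᵥ x) := by
  rw [Matrix.posDef_iff_dotProduct_mulVec]
  simp [Matrix.IsHermitian]

lemma mulVec_eq_zero_of_posSemidef {X : Matrix (Fin n) (Fin n) ℝ} (h : X.PosSemidef)
    {v : Fin n → ℝ} (hv : v ⬝ᵥ (X *ᵥ v) = 0) : X *ᵥ v = 0 :=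
  (h.dotProduct_mulVec_zero_iff v).1 (by simpa using hv)

lemma posSemidef_conj {X : Matrix (Fin n) (Fin n) ℝ} (h : X.PosSemidef)
    (V : Matrix (Fin n) (Fin m) ℝ) : (Vᵀ * X * V).PosSemidef := by
  simpa using h.conjTranspose_mul_mul_same V

lemma posSemidef_antisymm {X : Matrix (Fin n) (Fin n) ℝ} (h₁ : X.PosSemidef)
    (h₂ : (-X).PosSemidef) : X = 0 := by
  have h1 := h₁.trace_nonneg
  have h2 := h₂.trace_nonneg
  rw [Matrix.trace_neg] at h2
  exact h₁.trace_eq_zero_iff.1 (by linarith)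

open scoped MatrixOrder Matrix.Norms.L2Operator in
lemma exists_eq_transpose_mul_self {X : Matrix (Fin n) (Fin n) ℝ} (hX : X.PosSemidef) :
    ∃ E : Matrix (Fin n) (Fin n) ℝ, X = Eᵀ * E := by
  obtain ⟨E, hE⟩ := CStarAlgebra.nonneg_iff_eq_star_mul_self.1 hX.nonneg
  exact ⟨E, by simpa [Matrix.star_eq_conjTranspose] using hE⟩

lemma trace_mul_nonneg {X Y : Matrix (Fin n) (Fin n) ℝ} (hX : X.PosSemidef)
    (hY : Y.PosSemidef) : 0 ≤ (X * Y).trace := by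
  obtain ⟨E, rfl⟩ := exists_eq_transpose_mul_self hX
  rw [Matrix.mul_assoc, Matrix.trace_mul_comm, ← Matrix.transpose_transpose E]
  simpa using (posSemidef_conj hY Eᵀ).trace_nonneg

lemma mul_eq_zero_of_trace_mul_eq_zero {X Y : Matrix (Fin n) (Fin n) ℝ} (hX : X.PosSemidef)
    (hY : Y.PosSemidef) (h : (X * Y).trace = 0) : X * Y = 0 := by
  obtain ⟨E, rfl⟩ := exists_eq_transpose_mul_self hX
  obtain ⟨G, rfl⟩ := exists_eq_transpose_mul_self hY
  have h2 : E * Gᵀ = 0 := by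
    rw [← Matrix.trace_conjTranspose_mul_self_eq_zero_iff (R := ℝ)]
    rw [← h, Matrix.trace_mul_comm]
    simp only [Matrix.conjTranspose_eq_transpose_of_trivial, Matrix.transpose_mul,
      Matrix.transpose_transpose]
    rw [← Matrix.mul_assoc, Matrix.trace_mul_comm]
    simp only [Matrix.mul_assoc]
  rw [Matrix.mul_assoc, ← Matrix.mul_assoc E, h2]
  simp

lemma eq_zero_of_conj_eq_zero {R : Matrix (Fin n) (Fin n) ℝ} (hR : R.PosDef)
    {Y : Matrix (Fin n) (Fin m) ℝ} (h : Yᵀ * R * Y = 0) : Y = 0 := by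
  apply Matrix.ext_of_mulVec_single
  intro i
  by_contra hne
  rw [Matrix.zero_mulVec] at hne
  have h1 := (posDef_iff_real.1 hR).2 _ hne
  rw [Matrix.mulVec_mulVec, ← Matrix.vecMul_transpose, ← Matrix.dotProduct_mulVec,
    Matrix.mulVec_mulVec, ← Matrix.mul_assoc, h] at h1
  simp at h1

/-- Generalized Rayleigh quotient: a symmetric matrix that is not positive semidefinite becomes
positive semidefinite and singular after adding a suitable positive multiple of `P`. -/
lemma exists_add_smul_posSemidef_singular {X P : Matrix (Fin n) (Fin n) ℝ} (hX : Xᵀ = X)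
    (hP : P.PosDef) (hn : ¬ X.PosSemidef) :
    ∃ t : ℝ, 0 < t ∧ ∃ v : Fin n → ℝ, v ≠ 0 ∧ (X + t • P).PosSemidef ∧ (X + t • P) *ᵥ v = 0 := by
  obtain ⟨hPs, hPp⟩ := posDef_iff_real.1 hP
  obtain ⟨w, hw⟩ : ∃ w, w ⬝ᵥ (X *ᵥ w) < 0 := by
    by_contra! hc
    exact hn (posSemidef_iff_real.2 ⟨hX, hc⟩)
  have hw0 : w ≠ 0 := by
    rintro rfl
    simp at hw
  have hnorm : ∀ x : Fin n → ℝ, x ≠ 0 → ‖x‖⁻¹ • x ∈ Metric.sphere (0 : Fin n → ℝ) 1 := by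
    intro x hx
    rw [mem_sphere_zero_iff_norm, norm_smul, norm_inv, norm_norm,
      inv_mul_cancel₀ (norm_ne_zero_iff.2 hx)]
  have hne : ∀ x ∈ Metric.sphere (0 : Fin n → ℝ) 1, x ≠ 0 := by
    intro x hx h0
    rw [h0] at hx
    simp at hx
  let f : (Fin n → ℝ) → ℝ := fun x => (x ⬝ᵥ (X *ᵥ x)) / (x ⬝ᵥ (P *ᵥ x))
  have hcont : ContinuousOn f (Metric.sphere 0 1) := by
    apply ContinuousOn.div
    · exact Continuous.continuousOn (by fun_prop)
    · exact Continuous.continuousOn (by fun_prop)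
    · exact fun x hx => (hPp x (hne x hx)).ne'
  obtain ⟨v, hv, hmin⟩ := (isCompact_sphere (0 : Fin n → ℝ) 1).exists_isMinOn
    ⟨_, hnorm w hw0⟩ hcont
  have hscale : ∀ x : Fin n → ℝ, x ≠ 0 → f (‖x‖⁻¹ • x) = f x := by
    intro x hx
    have : ‖x‖⁻¹ ≠ 0 := inv_ne_zero (norm_ne_zero_iff.2 hx)
    have h2 := (hPp x hx).ne'
    simp only [f, Matrix.mulVec_smul, smul_dotProduct, dotProduct_smul, smul_eq_mul]
    field_simp
  have hle : ∀ x : Fin n → ℝ, x ≠ 0 → f v ≤ f x := by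
    intro x hx
    rw [← hscale x hx]
    exact hmin (hnorm x hx)
  have hquad : ∀ (t : ℝ) (x : Fin n → ℝ),
      x ⬝ᵥ ((X + t • P) *ᵥ x) = x ⬝ᵥ (X *ᵥ x) + t * (x ⬝ᵥ (P *ᵥ x)) := by
    intro t x
    rw [Matrix.add_mulVec, dotProduct_add, Matrix.smul_mulVec, dotProduct_smul, smul_eq_mul]
  have hpsd : (X + (-f v) • P).PosSemidef := by
    refine posSemidef_iff_real.2 ⟨by simp [hX, hPs], fun x => ?_⟩
    rcases eq_or_ne x 0 with rfl | hx
    · simp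
    · have h1 := hle x hx
      rw [hquad]
      have h2 := (le_div_iff₀ (hPp x hx)).1 h1
      linarith
  refine ⟨-f v, ?_, v, hne v hv, hpsd, mulVec_eq_zero_of_posSemidef hpsd ?_⟩
  · have h1 := hle w hw0
    have h2 : f w < 0 := div_neg_of_neg_of_pos hw (hPp w hw0)
    linarith
  · rw [hquad]
    have := (hPp v (hne v hv)).ne'
    simp only [f]
    field_simp
    ring

lemma exists_smul_sub_posDef {H P : Matrix (Fin n) (Fin n) ℝ} (hH : Hᵀ = H)
    (hP : P.PosDef) : ∃ c : ℝ, 0 < c ∧ (c • P - H).PosDef := by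
  by_cases h : (-H).PosSemidef
  · exact ⟨1, one_pos, by simpa [sub_eq_add_neg] using hP.add_posSemidef h⟩
  · obtain ⟨t, ht, -, -, h1, -⟩ := exists_add_smul_posSemidef_singular (by simp [hH]) hP h
    refine ⟨t + 1, by linarith, ?_⟩
    have : (t + 1) • P - H = P + (-H + t • P) := by rw [add_smul, one_smul]; abel
    rw [this]
    exact hP.add_posSemidef h1

lemma isClosed_setOf_posSemidef :
    IsClosed {X : Matrix (Fin n) (Fin n) ℝ | X.PosSemidef} := by
  simp only [posSemidef_iff_real, Set.ofPred_and, Set.ofPred_forall]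
  refine IsClosed.inter (isClosed_eq (by fun_prop) (by fun_prop)) (isClosed_iInter fun x => ?_)
  exact isClosed_le (by fun_prop) (by fun_prop)

lemma abs_apply_le_trace {X : Matrix (Fin n) (Fin n) ℝ} (h : X.PosSemidef) (i j : Fin n) :
    |X i j| ≤ X.trace := by
  obtain ⟨hs, hp⟩ := posSemidef_iff_real.1 h
  have hd : ∀ k, X k k ≤ X.trace := fun k =>
    Finset.single_le_sum (f := fun k => X k k) (fun k _ => h.diag_nonneg) (Finset.mem_univ k)
  have hij : X j i = X i j := congrFun (congrFun hs i) j
  have e1 : ∀ a b, Pi.single (M := fun _ => ℝ) a 1 ⬝ᵥ (X *ᵥ Pi.single b 1) = X a b := by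
    intro a b
    simp
  have h1 := hp (Pi.single i 1 + Pi.single j 1)
  have h2 := hp (Pi.single i 1 - Pi.single j 1)
  simp only [Matrix.mulVec_add, add_dotProduct, dotProduct_add, e1, hij] at h1
  simp only [Matrix.mulVec_sub, sub_dotProduct, dotProduct_sub, e1, hij] at h2
  have := hd i
  have := hd j
  rw [abs_le]
  constructor <;> linarith

lemma isCompact_setOf_posSemidef_trace_le (c : ℝ) :
    IsCompact {X : Matrix (Fin n) (Fin n) ℝ | X.PosSemidef ∧ X.trace ≤ c} := by
  have hK : IsCompact (Set.univ.pi fun _ : Fin n => Set.univ.pi fun _ : Fin n => Set.Icc (-c) c) :=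
    isCompact_univ_pi fun _ => isCompact_univ_pi fun _ => isCompact_Icc
  refine hK.of_isClosed_subset (isClosed_setOf_posSemidef.inter
    (isClosed_le continuous_id.matrix_trace continuous_const)) ?_
  rintro X ⟨hX, hc⟩ i - j -
  exact abs_le.1 ((abs_apply_le_trace hX i j).trans hc)

end Prelim

/-! ### Generalized Lyapunov operators -/

section Lyapunov

variable {n r : ℕ} {M : Matrix (Fin n) (Fin n) ℝ} {N : Fin r → Matrix (Fin n) (Fin n) ℝ}

lemma lyapOp_add (S T : Matrix (Fin n) (Fin n) ℝ) :
    lyapOp M N (S + T) = lyapOp M N S + lyapOp M N T := by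
  simp only [lyapOp, Matrix.mul_add, Matrix.add_mul, Finset.sum_add_distrib]
  abel

lemma lyapOp_smul (c : ℝ) (S : Matrix (Fin n) (Fin n) ℝ) :
    lyapOp M N (c • S) = c • lyapOp M N S := by
  simp [lyapOp, Finset.smul_sum]

lemma lyapOp_neg (S : Matrix (Fin n) (Fin n) ℝ) : lyapOp M N (-S) = -lyapOp M N S := by
  simpa using lyapOp_smul (M := M) (N := N) (-1) S

lemma lyapOp_sub (S T : Matrix (Fin n) (Fin n) ℝ) :
    lyapOp M N (S - T) = lyapOp M N S - lyapOp M N T := by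
  rw [sub_eq_add_neg, lyapOp_add, lyapOp_neg, sub_eq_add_neg]

lemma transpose_lyapOp (S : Matrix (Fin n) (Fin n) ℝ) :
    (lyapOp M N S)ᵀ = lyapOp M N Sᵀ := by
  simp only [lyapOp, Matrix.transpose_add, Matrix.transpose_mul, Matrix.transpose_sum,
    Matrix.transpose_transpose, Matrix.mul_assoc]
  abel

lemma continuous_lyapOp : Continuous (lyapOp M N) := by
  unfold lyapOp
  fun_prop

/-- Subtracting a multiple of the identity from the drift shifts the Lyapunov operator. -/
lemma lyapOp_shift (lam : ℝ) (S : Matrix (Fin n) (Fin n) ℝ) :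
    lyapOp (M - (lam / 2) • (1 : Matrix (Fin n) (Fin n) ℝ)) N S = lyapOp M N S - lam • S := by
  have : lam • S = (lam / 2) • S + (lam / 2) • S := by rw [← add_smul]; ring_nf
  rw [this]
  simp only [lyapOp, Matrix.sub_mul, Matrix.transpose_sub, Matrix.mul_sub,
    Matrix.transpose_smul, Matrix.transpose_one, Matrix.smul_mul, Matrix.mul_smul,
    Matrix.one_mul, Matrix.mul_one]
  abel

/-- The operator with transposed coefficients is the adjoint for the trace inner product. -/
lemma trace_mul_lyapOp (Y S : Matrix (Fin n) (Fin n) ℝ) :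
    (Y * lyapOp M N S).trace = (lyapOp Mᵀ (fun i => (N i)ᵀ) Y * S).trace := by
  simp only [lyapOp, Matrix.mul_add, Matrix.add_mul, Matrix.trace_add, Matrix.mul_sum,
    Matrix.sum_mul, Matrix.trace_sum, Matrix.transpose_transpose]
  have h1 : (Y * (M * S)).trace = (Y * M * S).trace := by rw [Matrix.mul_assoc]
  have h2 : (Y * (S * Mᵀ)).trace = (Mᵀ * Y * S).trace := by
    rw [← Matrix.mul_assoc, Matrix.trace_mul_comm, Matrix.mul_assoc]
  have h3 : ∀ i, (Y * (N i * S * (N i)ᵀ)).trace = ((N i)ᵀ * Y * N i * S).trace := by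
    intro i
    rw [← Matrix.mul_assoc, Matrix.trace_mul_comm]
    simp only [Matrix.mul_assoc]
  rw [h1, h2, Finset.sum_congr rfl fun i _ => h3 i]
  ring

/-- On the kernel of a positive semidefinite `Y` the quadratic form of `lyapOp M N Y` is
nonnegative, since only the completely positive part contributes. -/
lemma dotProduct_lyapOp_nonneg {Y : Matrix (Fin n) (Fin n) ℝ} (hY : Y.PosSemidef)
    {v : Fin n → ℝ} (hv : Y *ᵥ v = 0) : 0 ≤ v ⬝ᵥ (lyapOp M N Y *ᵥ v) := by
  have hs := isSymm_of_posSemidef hY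
  have hv' : v ᵥ* Y = 0 := by rw [← Matrix.mulVec_transpose, hs, hv]
  simp only [lyapOp, Matrix.add_mulVec, dotProduct_add, Matrix.sum_mulVec, dotProduct_sum]
  have h1 : v ⬝ᵥ ((M * Y) *ᵥ v) = 0 := by rw [← Matrix.mulVec_mulVec, hv]; simp
  have h2 : v ⬝ᵥ ((Y * Mᵀ) *ᵥ v) = 0 := by
    rw [← Matrix.mulVec_mulVec, Matrix.dotProduct_mulVec, hv']; simp
  rw [h1, h2]
  have h3 : 0 ≤ ∑ i, v ⬝ᵥ ((N i * Y * (N i)ᵀ) *ᵥ v) := by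
    refine Finset.sum_nonneg fun i _ => ?_
    have := posSemidef_conj hY (N i)ᵀ
    rw [Matrix.transpose_transpose] at this
    exact (posSemidef_iff_real.1 this).2 v
  linarith

variable (M N) in
/-- A Lyapunov certificate for `S ↦ M S + S Mᵀ + ∑ i, N i S (N i)ᵀ`: a positive definite matrix
which the operator maps to a negative definite one. It serves as the working notion of mean-square
stability; for `r = 0` it says that `M` is stable. -/
def HasCertificate : Prop :=
  ∃ P : Matrix (Fin n) (Fin n) ℝ, P.PosDef ∧ (-lyapOp M N P).PosDef

/-- Maximum principle: under a certificate, `lyapOp M N X ⪯ 0` forces `X ⪰ 0`. -/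
lemma HasCertificate.posSemidef_of_lyapOp (h : HasCertificate M N)
    {X : Matrix (Fin n) (Fin n) ℝ} (hX : Xᵀ = X) (hL : (-lyapOp M N X).PosSemidef) :
    X.PosSemidef := by
  obtain ⟨P, hP, hLP⟩ := h
  by_contra hn
  obtain ⟨t, ht, v, hv, hps, hker⟩ := exists_add_smul_posSemidef_singular hX hP hn
  have h1 := dotProduct_lyapOp_nonneg (M := M) (N := N) hps hker
  have h2 : (-lyapOp M N (X + t • P)).PosDef := by
    rw [lyapOp_add, lyapOp_smul, neg_add, ← smul_neg]
    exact (hLP.smul ht).posSemidef_add hL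
  have h3 := (posDef_iff_real.1 h2).2 v hv
  rw [Matrix.neg_mulVec, dotProduct_neg] at h3
  linarith

lemma HasCertificate.eq_zero_of_lyapOp (h : HasCertificate M N)
    {X : Matrix (Fin n) (Fin n) ℝ} (hX : Xᵀ = X) (hL : lyapOp M N X = 0) : X = 0 := by
  refine posSemidef_antisymm (h.posSemidef_of_lyapOp hX ?_)
    (h.posSemidef_of_lyapOp (X := -X) (by simp [hX]) ?_)
  · simpa [hL] using Matrix.PosSemidef.zero
  · simpa [lyapOp_neg, hL] using Matrix.PosSemidef.zero

/-- Generalized Lyapunov equations are solvable in symmetric matrices, since injectivity implies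
surjectivity in finite dimension. -/
lemma HasCertificate.exists_lyapOp_eq (h : HasCertificate M N)
    {W : Matrix (Fin n) (Fin n) ℝ} (hW : Wᵀ = W) :
    ∃ X : Matrix (Fin n) (Fin n) ℝ, Xᵀ = X ∧ lyapOp M N X = W := by
  let E : Submodule ℝ (Matrix (Fin n) (Fin n) ℝ) :=
    { carrier := {X | Xᵀ = X}
      add_mem' := fun {X Y} hX hY => by
        simp only [Set.mem_ofPred_eq] at hX hY ⊢
        rw [Matrix.transpose_add, hX, hY]
      zero_mem' := Matrix.transpose_zero
      smul_mem' := fun c X hX => by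
        simp only [Set.mem_ofPred_eq] at hX ⊢
        rw [Matrix.transpose_smul, hX] }
  let T : E →ₗ[ℝ] E :=
    { toFun := fun X => ⟨lyapOp M N X, by
        have : (X : Matrix (Fin n) (Fin n) ℝ)ᵀ = X := X.2
        change (lyapOp M N X)ᵀ = lyapOp M N X
        rw [transpose_lyapOp, this]⟩
      map_add' := fun X Y => Subtype.ext (lyapOp_add _ _)
      map_smul' := fun c X => Subtype.ext (lyapOp_smul _ _) }
  have hinj : Function.Injective T := by
    rw [injective_iff_map_eq_zero]
    intro X hX
    exact Subtype.ext (h.eq_zero_of_lyapOp X.2 (congrArg Subtype.val hX))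
  obtain ⟨X, hX⟩ := LinearMap.injective_iff_surjective.1 hinj ⟨W, hW⟩
  exact ⟨X, X.2, congrArg Subtype.val hX⟩

/-- A certificate survives adding nonnegative damping. -/
lemma HasCertificate.shift (h : HasCertificate M N) {lam : ℝ} (hl : 0 ≤ lam) :
    HasCertificate (M - (lam / 2) • (1 : Matrix (Fin n) (Fin n) ℝ)) N := by
  obtain ⟨P, hP, hL⟩ := h
  refine ⟨P, hP, ?_⟩
  rw [lyapOp_shift, neg_sub, sub_eq_add_neg]
  exact hL.posSemidef_add (hP.posSemidef.smul hl)

lemma HasCertificate.no_eigenvector (h : HasCertificate M N) {lam : ℝ} (hl : 0 ≤ lam)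
    {S : Matrix (Fin n) (Fin n) ℝ} (hS : Sᵀ = S) (hE : lyapOp M N S = lam • S) : S = 0 :=
  (h.shift hl).eq_zero_of_lyapOp hS (by rw [lyapOp_shift, hE, sub_self])

/-- Certificates are an open condition: a little damping can be removed. -/
lemma HasCertificate.exists_unshift {lam : ℝ} (hl : 0 < lam)
    (h : HasCertificate (M - (lam / 2) • (1 : Matrix (Fin n) (Fin n) ℝ)) N) :
    ∃ mu, 0 ≤ mu ∧ mu < lam ∧
      HasCertificate (M - (mu / 2) • (1 : Matrix (Fin n) (Fin n) ℝ)) N := by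
  obtain ⟨P, hP, hL⟩ := h
  obtain ⟨c, hc, hcP⟩ := exists_smul_sub_posDef (isSymm_of_posDef hP) hL
  have hmono : ∀ d, c ≤ d → (d • (-lyapOp (M - (lam / 2) • (1 : Matrix (Fin n) (Fin n) ℝ)) N P)
      - P).PosDef := by
    intro d hd
    have := hcP.add_posSemidef (hL.posSemidef.smul (sub_nonneg.2 hd))
    rw [sub_smul] at this
    convert this using 1
    abel
  -- `d` large enough that the removed damping `1 / d` does not exceed `lam`
  set d := max c (1 / lam) with hd
  have hd0 : 0 < d := hc.trans_le (le_max_left _ _)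
  have hdl : d⁻¹ ≤ lam := by
    rw [inv_le_comm₀ hd0 hl, ← one_div]
    exact le_max_right _ _
  refine ⟨lam - d⁻¹, sub_nonneg.2 hdl, by linarith [inv_pos.2 hd0], P, hP, ?_⟩
  have h1 := (hmono d (le_max_left _ _)).smul (inv_pos.2 hd0)
  rw [smul_sub, smul_smul, inv_mul_cancel₀ hd0.ne', one_smul] at h1
  convert h1 using 1
  rw [lyapOp_shift, lyapOp_shift, sub_smul]
  abel

/-- Perron–Frobenius alternative: without a certificate the operator has a positive semidefinite
eigenvector for a nonnegative eigenvalue. The eigenvalue is the least `lam ≥ 0` for which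
`lyapOp M N U - lam U = -a I` has a normalized solution with `U ⪰ 0` and `a ≥ 0`; there `a > 0`
would produce a certificate for a smaller damping. -/
theorem exists_eigenvector_of_not_hasCertificate (h : ¬ HasCertificate M N) :
    ∃ lam : ℝ, 0 ≤ lam ∧ ∃ S : Matrix (Fin n) (Fin n) ℝ,
      S.PosSemidef ∧ S ≠ 0 ∧ lyapOp M N S = lam • S := by
  by_contra! hno
  have hcone : (1 : Matrix (Fin n) (Fin n) ℝ).PosDef := Matrix.PosDef.one
  -- a certificate for some damping yields a normalized solution
  have hmk : ∀ lam : ℝ, HasCertificate (M - (lam / 2) • (1 : Matrix (Fin n) (Fin n) ℝ)) N →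
      ∃ U : Matrix (Fin n) (Fin n) ℝ, ∃ a : ℝ, U.PosSemidef ∧ 0 ≤ a ∧ U.trace + a = 1 ∧
        lyapOp M N U - lam • U = -(a • (1 : Matrix (Fin n) (Fin n) ℝ)) := by
    intro lam hc
    obtain ⟨X, hX, hXL⟩ := hc.exists_lyapOp_eq
      (W := -(1 : Matrix (Fin n) (Fin n) ℝ)) (by simp)
    have hXp : X.PosSemidef := hc.posSemidef_of_lyapOp hX (by
      rw [hXL, neg_neg]; exact hcone.posSemidef)
    have htr := hXp.trace_nonneg
    have h0 : 0 < X.trace + 1 := by linarith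
    refine ⟨(X.trace + 1)⁻¹ • X, (X.trace + 1)⁻¹, hXp.smul (inv_nonneg.2 h0.le),
      inv_nonneg.2 h0.le, ?_, ?_⟩
    · rw [Matrix.trace_smul, smul_eq_mul]
      field_simp
    · rw [lyapOp_shift] at hXL
      rw [lyapOp_smul, smul_comm lam, ← smul_sub, hXL, smul_neg]
  -- large damping always admits the certificate `1`
  obtain ⟨c, hc, hcP⟩ := exists_smul_sub_posDef (H := lyapOp M N 1) (P := 1)
    (by rw [transpose_lyapOp, Matrix.transpose_one]) hcone
  have hcc : HasCertificate (M - (c / 2) • (1 : Matrix (Fin n) (Fin n) ℝ)) N :=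
    ⟨1, hcone, by rwa [lyapOp_shift, neg_sub]⟩
  let K : Set (ℝ × Matrix (Fin n) (Fin n) ℝ × ℝ) :=
    {q | (q.1 ∈ Set.Icc 0 c ∧ (q.2.1.PosSemidef ∧ q.2.1.trace ≤ 1) ∧ q.2.2 ∈ Set.Icc 0 1) ∧
      q.2.1.trace + q.2.2 = 1 ∧
      lyapOp M N q.2.1 - q.1 • q.2.1 = -(q.2.2 • (1 : Matrix (Fin n) (Fin n) ℝ))}
  have hK : IsCompact K := by
    have h1 : IsCompact (Set.Icc 0 c ×ˢ
        ({X : Matrix (Fin n) (Fin n) ℝ | X.PosSemidef ∧ X.trace ≤ 1} ×ˢ Set.Icc (0 : ℝ) 1)) :=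
      isCompact_Icc.prod ((isCompact_setOf_posSemidef_trace_le 1).prod isCompact_Icc)
    refine h1.inter_right (t := {q | q.2.1.trace + q.2.2 = 1 ∧
      lyapOp M N q.2.1 - q.1 • q.2.1 = -(q.2.2 • (1 : Matrix (Fin n) (Fin n) ℝ))}) ?_
    refine IsClosed.inter (isClosed_eq ?_ continuous_const) (isClosed_eq ?_ ?_)
    · exact (continuous_snd.fst.matrix_trace).add continuous_snd.snd
    · exact (continuous_lyapOp.comp continuous_snd.fst).sub
        (continuous_fst.smul continuous_snd.fst)
    · exact (continuous_snd.snd.smul continuous_const).neg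
  have hmem : ∀ lam ∈ Set.Icc 0 c,
      HasCertificate (M - (lam / 2) • (1 : Matrix (Fin n) (Fin n) ℝ)) N →
      ∃ q ∈ K, q.1 = lam := by
    intro lam hl hce
    obtain ⟨U, a, hU, ha, htr, heq⟩ := hmk lam hce
    have := hU.trace_nonneg
    exact ⟨(lam, U, a), ⟨⟨hl, ⟨hU, by dsimp only; linarith⟩, ha, by dsimp only; linarith⟩,
      htr, heq⟩, rfl⟩
  obtain ⟨q₀, hq₀, -⟩ := hmem c ⟨hc.le, le_rfl⟩ hcc
  obtain ⟨⟨lam, U, a⟩, hq, hmin⟩ := hK.exists_isMinOn ⟨q₀, hq₀⟩ continuous_fst.continuousOn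
  obtain ⟨⟨⟨hl0, hlc⟩, ⟨hU, -⟩, ha0, -⟩, htr, heq⟩ := hq
  dsimp only at hl0 hlc hU ha0 htr heq
  have ha : 0 < a := by
    refine lt_of_le_of_ne ha0 fun h0 => ?_
    rw [← h0, zero_smul, neg_zero, sub_eq_zero] at heq
    refine hno lam hl0 U hU ?_ heq
    rintro rfl
    rw [← h0, Matrix.trace_zero, add_zero] at htr
    exact zero_ne_one htr
  have hUd : U.PosDef := by
    refine posDef_iff_real.2 ⟨isSymm_of_posSemidef hU, fun v hv => ?_⟩
    refine lt_of_le_of_ne ((posSemidef_iff_real.1 hU).2 v) fun h0 => ?_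
    have hk := mulVec_eq_zero_of_posSemidef hU h0.symm
    have h1 := dotProduct_lyapOp_nonneg (M := M) (N := N) hU hk
    rw [sub_eq_iff_eq_add.1 heq, Matrix.add_mulVec, Matrix.smul_mulVec lam, hk,
      Matrix.neg_mulVec, Matrix.smul_mulVec, Matrix.one_mulVec, smul_zero, add_zero,
      dotProduct_neg, dotProduct_smul, smul_eq_mul] at h1
    have h2 : 0 < v ⬝ᵥ v := by simpa using (posDef_iff_real.1 hcone).2 v hv
    nlinarith
  have hcert : HasCertificate (M - (lam / 2) • (1 : Matrix (Fin n) (Fin n) ℝ)) N :=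
    ⟨U, hUd, by rw [lyapOp_shift, heq, neg_neg]; exact hcone.smul ha⟩
  rcases hl0.eq_or_lt with h0 | hpos
  · rw [← h0] at hcert
    exact h (by simpa using hcert)
  · obtain ⟨mu, hmu0, hmul, hmuc⟩ := hcert.exists_unshift hpos
    obtain ⟨q, hqK, hq1⟩ := hmem mu ⟨hmu0, hmul.le.trans hlc⟩ hmuc
    have := hmin hqK
    simp only [Set.mem_ofPred_eq] at this
    linarith

lemma HasCertificate.transpose (h : HasCertificate M N) :
    HasCertificate Mᵀ (fun i => (N i)ᵀ) := by
  by_contra hn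
  obtain ⟨lam, hl, Y, hY, hY0, hE⟩ := exists_eigenvector_of_not_hasCertificate hn
  have hYs := isSymm_of_posSemidef hY
  obtain ⟨S, -, hSL⟩ := (h.shift hl).exists_lyapOp_eq hYs
  rw [lyapOp_shift] at hSL
  have h1 := trace_mul_lyapOp (M := M) (N := N) Y S
  rw [hE, sub_eq_iff_eq_add.1 hSL, Matrix.mul_add, Matrix.trace_add, Matrix.mul_smul,
    Matrix.smul_mul] at h1
  have h2 : (Yᴴ * Y).trace = 0 := by
    rw [Matrix.conjTranspose_eq_transpose_of_trivial, hYs]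
    linarith
  exact hY0 (Matrix.trace_conjTranspose_mul_self_eq_zero_iff.1 h2)

end Lyapunov

/-! ### Stable matrices and exponentially stable equations -/

section Stability

variable {n r : ℕ}

/-- Sylvester's theorem: `M E + E N = 0` has only the zero solution when the spectra of `M` and
`-N` are disjoint. With `p` the characteristic polynomial of `M`, the equation gives
`0 = p(M) E = E p(-N)`, and `p(-N)` is invertible. -/
lemma sylvester_eq_zero {M N E : Matrix (Fin n) (Fin n) ℂ} (h : M * E + E * N = 0)
    (hd : ∀ z ∈ spectrum ℂ (-N), z ∉ spectrum ℂ M) : E = 0 := by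
  have hc : M * E = E * (-N) := by rw [Matrix.mul_neg]; exact eq_neg_of_add_eq_zero_left h
  have hp : ∀ p : Polynomial ℂ, Polynomial.aeval M p * E = E * Polynomial.aeval (-N) p := by
    intro p
    induction p using Polynomial.induction_on' with
    | add p q hp hq => rw [map_add, map_add, add_mul, mul_add, hp, hq]
    | monomial k a =>
      have hk : M ^ k * E = E * (-N) ^ k := by
        induction k with
        | zero => simp
        | succ k ih => rw [pow_succ, mul_assoc, hc, ← mul_assoc, ih, mul_assoc, ← pow_succ]
      rw [Polynomial.aeval_monomial, Polynomial.aeval_monomial, mul_assoc, hk,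
        ← mul_assoc, ← mul_assoc, Algebra.commutes]
  have h0 := hp M.charpoly
  rw [Matrix.aeval_self_charpoly, zero_mul] at h0
  cases n with
  | zero => exact Subsingleton.elim _ _
  | succ n =>
    have hu : IsUnit (Polynomial.aeval (-N) M.charpoly) := by
      rw [← spectrum.zero_notMem_iff ℂ,
        spectrum.map_polynomial_aeval_of_nonempty (-N) _
          (spectrum.nonempty_of_isAlgClosed_of_finiteDimensional ℂ (-N))]
      rintro ⟨z, hz, hz0⟩
      exact hd z hz (Matrix.mem_spectrum_iff_isRoot_charpoly.2 hz0)
    exact (hu.mul_left_eq_zero).1 h0.symm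

lemma IsStable.transpose {M : Matrix (Fin n) (Fin n) ℝ} (h : IsStable M) : IsStable Mᵀ := by
  intro z hz
  refine h z ?_
  rw [Matrix.mem_spectrum_iff_isRoot_charpoly] at hz ⊢
  rwa [Matrix.transpose_map, Matrix.charpoly_transpose] at hz

/-- The real Sylvester equation `M E + E (N - lam) = 0` for stable `M`, `N` and `lam ≥ 0`. -/
lemma IsStable.sylvester {M N E : Matrix (Fin n) (Fin n) ℝ} (hM : IsStable M) (hN : IsStable N)
    {lam : ℝ} (hl : 0 ≤ lam) (h : M * E + E * N = lam • E) : E = 0 := by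
  let φ : Matrix (Fin n) (Fin n) ℝ → Matrix (Fin n) (Fin n) ℂ := fun X => X.map (algebraMap ℝ ℂ)
  have hmul : ∀ X Y, φ (X * Y) = φ X * φ Y := fun X Y => Matrix.map_mul
  have hadd : ∀ X Y, φ (X + Y) = φ X + φ Y := fun X Y =>
    Matrix.map_add _ (map_add (algebraMap ℝ ℂ)) X Y
  have hE : φ (lam • E) = (lam : ℂ) • φ E := by
    ext i j
    simp [φ]
  have h1 : φ M * φ E + φ E * (φ N - algebraMap ℂ _ (lam : ℂ)) = 0 := by
    have h2 := congrArg φ h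
    rw [hadd, hmul, hmul, hE] at h2
    rw [mul_sub, ← Algebra.commutes, ← Algebra.smul_def, ← h2]
    abel
  have h3 := sylvester_eq_zero h1 (by
    intro z hz hzM
    have h4 := hM z hzM
    rw [neg_sub, ← spectrum.singleton_sub_eq, Set.singleton_sub] at hz
    obtain ⟨y, hy, rfl⟩ := hz
    have h5 := hN y hy
    rw [Complex.sub_re, Complex.ofReal_re] at h4
    linarith)
  ext i j
  have := congrFun (congrFun h3 i) j
  simpa [φ] using this

lemma IsStable.hasCertificate {M : Matrix (Fin n) (Fin n) ℝ} (h : IsStable M)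
    (N : Fin 0 → Matrix (Fin n) (Fin n) ℝ) : HasCertificate M N := by
  by_contra hn
  obtain ⟨lam, hl, S, -, hS0, hE⟩ := exists_eigenvector_of_not_hasCertificate hn
  refine hS0 (h.sylvester h.transpose hl ?_)
  simpa [lyapOp] using hE

lemma HasCertificate.isStable {M : Matrix (Fin n) (Fin n) ℝ}
    {N : Fin 0 → Matrix (Fin n) (Fin n) ℝ} (h : HasCertificate Mᵀ N) : IsStable M := by
  obtain ⟨P, hP, hL⟩ := h
  have hPs := isSymm_of_posDef hP
  intro z hz
  rw [Matrix.mem_spectrum_iff_isRoot_charpoly, Polynomial.IsRoot, Matrix.eval_charpoly,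
    ← Matrix.exists_mulVec_eq_zero_iff] at hz
  obtain ⟨w, hw0, hw⟩ := hz
  -- real and imaginary parts of an eigenvector
  let a : Fin n → ℝ := fun i => (w i).re
  let b : Fin n → ℝ := fun i => (w i).im
  have hcoord : ∀ i, ∑ j, (M i j : ℂ) * w j = z * w i := by
    intro i
    have := congrFun hw i
    rw [Matrix.sub_mulVec] at this
    simp only [Matrix.scalar_apply, Pi.sub_apply, Pi.zero_apply, Matrix.mulVec_diagonal] at this
    exact (sub_eq_zero.1 this).symm
  have ha : M *ᵥ a = z.re • a - z.im • b := by
    ext i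
    have := congrArg Complex.re (hcoord i)
    simpa [Matrix.mulVec, dotProduct, a, b] using this
  have hb : M *ᵥ b = z.re • b + z.im • a := by
    ext i
    have := congrArg Complex.im (hcoord i)
    simpa [Matrix.mulVec, dotProduct, a, b] using this
  have hq : ∀ v, v ⬝ᵥ (-lyapOp Mᵀ N P *ᵥ v) = -(2 * (v ⬝ᵥ (P *ᵥ (M *ᵥ v)))) := by
    intro v
    have h1 : v ⬝ᵥ (Mᵀ *ᵥ (P *ᵥ v)) = v ⬝ᵥ (P *ᵥ (M *ᵥ v)) := by
      rw [Matrix.dotProduct_mulVec, Matrix.vecMul_transpose, dotProduct_comm,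
        ← Matrix.vecMul_transpose, hPs, ← Matrix.dotProduct_mulVec]
    simp only [lyapOp, Finset.univ_eq_empty, Finset.sum_empty, add_zero, Matrix.neg_mulVec,
      dotProduct_neg, Matrix.add_mulVec, dotProduct_add, Matrix.transpose_transpose,
      ← Matrix.mulVec_mulVec, h1]
    ring
  have hsym : b ⬝ᵥ (P *ᵥ a) = a ⬝ᵥ (P *ᵥ b) := by
    rw [Matrix.dotProduct_mulVec, ← Matrix.mulVec_transpose, hPs, dotProduct_comm]
  obtain ⟨-, hPp⟩ := posDef_iff_real.1 hP
  obtain ⟨-, hLp⟩ := posDef_iff_real.1 hL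
  have hPn := (posSemidef_iff_real.1 hP.posSemidef).2
  have hLn := (posSemidef_iff_real.1 hL.posSemidef).2
  have hsum : a ⬝ᵥ (-lyapOp Mᵀ N P *ᵥ a) + b ⬝ᵥ (-lyapOp Mᵀ N P *ᵥ b) =
      -(2 * z.re * (a ⬝ᵥ (P *ᵥ a) + b ⬝ᵥ (P *ᵥ b))) := by
    rw [hq, hq, ha, hb]
    simp only [Matrix.mulVec_add, Matrix.mulVec_sub, Matrix.mulVec_smul, dotProduct_add,
      dotProduct_sub, dotProduct_smul, smul_eq_mul, hsym]
    ring
  have hab : a ≠ 0 ∨ b ≠ 0 := by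
    by_contra! hc
    refine hw0 (funext fun i => Complex.ext ?_ ?_)
    · exact congrFun hc.1 i
    · exact congrFun hc.2 i
  have hPab : 0 < a ⬝ᵥ (P *ᵥ a) + b ⬝ᵥ (P *ᵥ b) := by
    rcases hab with h | h
    · linarith [hPp _ h, hPn b]
    · linarith [hPp _ h, hPn a]
  have hLab : 0 < a ⬝ᵥ (-lyapOp Mᵀ N P *ᵥ a) + b ⬝ᵥ (-lyapOp Mᵀ N P *ᵥ b) := by
    rcases hab with h | h
    · linarith [hLp _ h, hLn b]
    · linarith [hLp _ h, hLn a]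
  rw [hsum] at hLab
  by_contra! hz0
  nlinarith [mul_nonneg hz0 hPab.le]

open scoped Matrix.Norms.Frobenius in
/-- An eigenvector `S` for an eigenvalue `lam ≥ 0` would give the solution `exp (lam t) S`, which
does not decay. -/
lemma IsExpStable.hasCertificate {M : Matrix (Fin n) (Fin n) ℝ}
    {N : Fin r → Matrix (Fin n) (Fin n) ℝ} (h : IsExpStable M N) : HasCertificate M N := by
  by_contra hn
  obtain ⟨lam, hl, S, hS, hS0, hE⟩ := exists_eigenvector_of_not_hasCertificate hn
  obtain ⟨β, hβ, α, hα, hdec⟩ := h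
  have h1 := hdec (fun t => Real.exp (lam * t) • S)
    (fun t => by simp [Matrix.IsSymm, isSymm_of_posSemidef hS])
    (fun t i j => by
      rw [lyapOp_smul, hE]
      have h2 : HasDerivAt (fun s : ℝ => Real.exp (lam * s)) (Real.exp (lam * t) * (lam * 1)) t :=
        ((hasDerivAt_id t).const_mul lam).exp
      have h3 := h2.mul_const (S i j)
      simp only [Matrix.smul_apply, smul_eq_mul]
      rwa [mul_one, mul_assoc] at h3)
    0
  have hSn : 0 < ‖S‖ := norm_pos_iff.2 hS0
  have h4 : ∀ t : ℝ, 0 ≤ t → 1 ≤ β * Real.exp (-α * t) := by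
    intro t ht
    have h5 := h1 t ht
    simp only [norm_smul, Real.norm_eq_abs, Real.abs_exp, mul_zero, Real.exp_zero, abs_one, one_mul,
      sub_zero] at h5
    have h6 := le_of_mul_le_mul_right h5 hSn
    exact (Real.one_le_exp (mul_nonneg hl ht)).trans h6
  have h7 : Tendsto (fun t : ℝ => β * Real.exp (-α * t)) atTop (𝓝 (β * 0)) := by
    refine (Real.tendsto_exp_atBot.comp ?_).const_mul β
    exact tendsto_id.const_mul_atTop_of_neg (by linarith)
  rw [mul_zero] at h7
  obtain ⟨t, ht, ht0⟩ := ((h7.eventually_lt_const one_pos).and (eventually_ge_atTop 0)).exists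
  exact absurd (h4 t ht0) (not_le.2 ht)

/-- Stabilizing solutions of a Riccati equation with symmetric coefficients are unique. Stability
makes `X - Xᵀ` vanish through a Sylvester equation, and then the difference of two solutions. -/
lemma IsStabilizingSolution.unique {A G H X Y : Matrix (Fin n) (Fin n) ℝ} (hG : Gᵀ = G)
    (hH : Hᵀ = H) (hX : IsStabilizingSolution A G H X) (hY : IsStabilizingSolution A G H Y) :
    X = Y := by
  have hsymm : Xᵀ = X := by
    have hT : Xᵀ * A + Aᵀ * Xᵀ - Xᵀ * G * Xᵀ + H = 0 := by
      have := congrArg Matrix.transpose hX.1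
      simpa [hG, hH, Matrix.mul_assoc] using this
    refine sub_eq_zero.1 (hX.2.transpose.sylvester hX.2 le_rfl ?_)
    rw [zero_smul]
    have e : (A - G * X)ᵀ * (Xᵀ - X) + (Xᵀ - X) * (A - G * X) =
        (Xᵀ * A + Aᵀ * Xᵀ - Xᵀ * G * Xᵀ + H) - (Aᵀ * X + X * A - X * G * X + H) := by
      rw [Matrix.transpose_sub, Matrix.transpose_mul, hG]
      noncomm_ring
    rw [e, hT, hX.1, sub_zero]
  refine sub_eq_zero.1 (hX.2.transpose.sylvester hY.2 le_rfl ?_)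
  rw [zero_smul]
  have e : (A - G * X)ᵀ * (X - Y) + (X - Y) * (A - G * Y) =
      (Aᵀ * X + X * A - X * G * X + H) - (Aᵀ * Y + Y * A - Y * G * Y + H) := by
    rw [Matrix.transpose_sub, Matrix.transpose_mul, hG, hsymm]
    noncomm_ring
  rw [e, hX.1, hY.1, sub_zero]

end Stability

/-! ### Closed loops and completion of squares -/

namespace Data

section Theory

variable {n m r : ℕ} {D : Data n m r}

lemma completion_of_squares {S : Matrix (Fin m) (Fin m) ℝ} (hS : S.PosDef)
    (T : Matrix (Fin n) (Fin n) ℝ) (W : Matrix (Fin n) (Fin m) ℝ) (F : Matrix (Fin m) (Fin n) ℝ) :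
    T + W * F + Fᵀ * Wᵀ + Fᵀ * S * F =
      (T - W * S⁻¹ * Wᵀ) + (F + S⁻¹ * Wᵀ)ᵀ * S * (F + S⁻¹ * Wᵀ) := by
  have hs := isSymm_of_posDef hS
  have hdet : IsUnit S.det := hS.det_pos.ne'.isUnit
  have h1 : S * (S⁻¹ * Wᵀ) = Wᵀ := Matrix.mul_nonsing_inv_cancel_left _ _ hdet
  have h2 : (S⁻¹ * Wᵀ)ᵀ = W * S⁻¹ := by
    rw [Matrix.transpose_mul, Matrix.transpose_transpose, Matrix.transpose_nonsing_inv, hs]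
  have h3 : W * S⁻¹ * S = W := Matrix.nonsing_inv_mul_cancel_right _ _ hdet
  rw [Matrix.transpose_add, h2, Matrix.add_mul, h3, Matrix.add_mul, Matrix.mul_add, Matrix.mul_add,
    Matrix.mul_assoc Fᵀ S (S⁻¹ * Wᵀ), h1, Matrix.mul_assoc W S⁻¹ Wᵀ]
  abel

variable (D) in
/-- The running cost of the feedback `F`: the block weight `[Q L; Lᵀ R]` compressed to the graph
of `F`. -/
def cost (F : Matrix (Fin m) (Fin n) ℝ) : Matrix (Fin n) (Fin n) ℝ :=
  D.Q + D.L * F + Fᵀ * D.Lᵀ + Fᵀ * D.R * F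

variable (D) in
/-- The left-hand side of the generalized Lyapunov equation for the value of the feedback `F`. -/
def closedLoop (X : Matrix (Fin n) (Fin n) ℝ) (F : Matrix (Fin m) (Fin n) ℝ) :
    Matrix (Fin n) (Fin n) ℝ :=
  lyapOp (D.A + D.B * F)ᵀ (fun i => (D.A₀ i + D.B₀ i * F)ᵀ) X + D.cost F

variable (D) in
/-- The feedback minimizing `F ↦ closedLoop X F`. -/
noncomputable def gain (X : Matrix (Fin n) (Fin n) ℝ) : Matrix (Fin m) (Fin n) ℝ :=
  -((D.Rc X)⁻¹ * (X * D.B + D.Lc X)ᵀ)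

variable (D) in
/-- The feedback `F` is mean-square stabilizing; stated with the adjoint operator, the one that
occurs in `closedLoop`. -/
def IsStableLoop (F : Matrix (Fin m) (Fin n) ℝ) : Prop :=
  HasCertificate (D.A + D.B * F)ᵀ (fun i => (D.A₀ i + D.B₀ i * F)ᵀ)

variable (D) in
/-- The Schur complement `Q - L R⁻¹ Lᵀ` of the weight. -/
noncomputable def schur : Matrix (Fin n) (Fin n) ℝ := D.Q - D.L * D.R⁻¹ * D.Lᵀ

lemma posDef_Rc (hR : D.R.PosDef) {X : Matrix (Fin n) (Fin n) ℝ} (hX : X.PosSemidef) :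
    (D.Rc X).PosDef :=
  hR.add_posSemidef (Matrix.posSemidef_sum _ fun i _ => posSemidef_conj hX (D.B₀ i))

lemma cost_eq (hR : D.R.PosDef) (F : Matrix (Fin m) (Fin n) ℝ) :
    D.cost F = D.schur + (F + D.R⁻¹ * D.Lᵀ)ᵀ * D.R * (F + D.R⁻¹ * D.Lᵀ) :=
  completion_of_squares hR D.Q D.L F

lemma sum_conj_add_mul {X : Matrix (Fin n) (Fin n) ℝ} (hX : Xᵀ = X)
    (F : Matrix (Fin m) (Fin n) ℝ) :
    ∑ i, (D.A₀ i + D.B₀ i * F)ᵀ * X * (D.A₀ i + D.B₀ i * F) =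
      D.Pi11 X + D.Pi12 X * F + Fᵀ * (D.Pi12 X)ᵀ + Fᵀ * D.Pi22 X * F := by
  simp only [Pi11, Pi12, Pi22, Matrix.sum_mul, Matrix.mul_sum, Matrix.transpose_sum,
    ← Finset.sum_add_distrib]
  refine Finset.sum_congr rfl fun i _ => ?_
  simp only [Matrix.transpose_add, Matrix.transpose_mul, Matrix.transpose_transpose, hX,
    Matrix.mul_add, Matrix.add_mul, Matrix.mul_assoc]
  abel

lemma closedLoop_eq (hR : D.R.PosDef) {X : Matrix (Fin n) (Fin n) ℝ} (hX : X.PosSemidef)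
    (F : Matrix (Fin m) (Fin n) ℝ) :
    D.closedLoop X F =
      D.residual X + (F - D.gain X)ᵀ * D.Rc X * (F - D.gain X) := by
  have hs := isSymm_of_posSemidef hX
  have h1 := completion_of_squares (posDef_Rc hR hX) (D.Aᵀ * X + X * D.A + D.Q + D.Pi11 X)
    (X * D.B + D.L + D.Pi12 X) F
  have h2 : D.closedLoop X F = D.Aᵀ * X + X * D.A + D.Q + D.Pi11 X
      + (X * D.B + D.L + D.Pi12 X) * F + Fᵀ * (X * D.B + D.L + D.Pi12 X)ᵀ
      + Fᵀ * D.Rc X * F := by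
    have h3 := sum_conj_add_mul (D := D) hs F
    simp only [closedLoop, lyapOp, Matrix.transpose_transpose, h3, cost, Rc]
    simp only [Matrix.transpose_add, Matrix.transpose_mul, Matrix.add_mul, Matrix.mul_add, hs,
      Matrix.mul_assoc]
    abel
  have h4 : F - D.gain X = F + (D.Rc X)⁻¹ * (X * D.B + D.L + D.Pi12 X)ᵀ := by
    rw [gain, sub_neg_eq_add, Lc, add_assoc (X * D.B)]
  rw [h2, h1, h4]
  rfl

lemma closedLoop_gain (hR : D.R.PosDef) {X : Matrix (Fin n) (Fin n) ℝ} (hX : X.PosSemidef) :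
    D.closedLoop X (D.gain X) = D.residual X := by
  rw [closedLoop_eq hR hX, sub_self]
  simp

lemma posSemidef_closedLoop_sub_residual (hR : D.R.PosDef) {X : Matrix (Fin n) (Fin n) ℝ}
    (hX : X.PosSemidef) (F : Matrix (Fin m) (Fin n) ℝ) :
    (D.closedLoop X F - D.residual X).PosSemidef := by
  rw [closedLoop_eq hR hX, add_sub_cancel_left]
  exact posSemidef_conj (posDef_Rc hR hX).posSemidef _

/-- Values of a stabilizing feedback are compared through their Lyapunov residuals. -/
lemma IsStableLoop.posSemidef_sub {F : Matrix (Fin m) (Fin n) ℝ} (hF : D.IsStableLoop F)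
    {X Y : Matrix (Fin n) (Fin n) ℝ} (hX : Xᵀ = X) (hY : Yᵀ = Y)
    (h : (D.closedLoop X F - D.closedLoop Y F).PosSemidef) : (Y - X).PosSemidef := by
  refine HasCertificate.posSemidef_of_lyapOp hF (by rw [Matrix.transpose_sub, hX, hY]) ?_
  rw [lyapOp_sub, neg_sub]
  simpa [closedLoop] using h

variable (D) in
/-- The standing assumptions of the Riccati theory. Detectability is used in the form of an
eigenvector test: a positive semidefinite eigenvector of the uncontrolled operator that is not seen
by the weight belongs to a negative eigenvalue. -/
structure IsRegular : Prop where
  posDef_R : D.R.PosDef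
  posSemidef_schur : D.schur.PosSemidef
  exists_isStableLoop : ∃ F, D.IsStableLoop F
  eq_zero_of_unobserved : ∀ (lam : ℝ) (S : Matrix (Fin n) (Fin n) ℝ), 0 ≤ lam → S.PosSemidef →
    D.schur * S = 0 →
    lyapOp (D.A - D.B * D.R⁻¹ * D.Lᵀ) (fun i => D.A₀ i - D.B₀ i * D.R⁻¹ * D.Lᵀ) S = lam • S →
    S = 0

lemma IsRegular.posSemidef_cost (hD : D.IsRegular) (F : Matrix (Fin m) (Fin n) ℝ) :
    (D.cost F).PosSemidef := by
  rw [cost_eq hD.posDef_R]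
  exact hD.posSemidef_schur.add (posSemidef_conj hD.posDef_R.posSemidef _)

/-- A feedback admitting a positive semidefinite supersolution is stabilizing. Otherwise a
Perron–Frobenius eigenvector `S` of the closed loop has `tr (cost F * S) = 0`, so it is unobserved
and the feedback acts on it like `-R⁻¹ Lᵀ`, contrary to detectability. -/
lemma IsRegular.isStableLoop (hD : D.IsRegular) {X : Matrix (Fin n) (Fin n) ℝ}
    (hX : X.PosSemidef) {F : Matrix (Fin m) (Fin n) ℝ} (h : (-D.closedLoop X F).PosSemidef) :
    D.IsStableLoop F := by
  refine HasCertificate.transpose (M := D.A + D.B * F) (N := fun i => D.A₀ i + D.B₀ i * F) ?_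
  by_contra hn
  obtain ⟨lam, hl, S, hS, hS0, hE⟩ := exists_eigenvector_of_not_hasCertificate hn
  have hSs := isSymm_of_posSemidef hS
  set V := F + D.R⁻¹ * D.Lᵀ with hV
  have hVR : (Vᵀ * D.R * V).PosSemidef := posSemidef_conj hD.posDef_R.posSemidef V
  have h1 := trace_mul_lyapOp (M := D.A + D.B * F) (N := fun i => D.A₀ i + D.B₀ i * F) X S
  have h2 : lyapOp (D.A + D.B * F)ᵀ (fun i => (D.A₀ i + D.B₀ i * F)ᵀ) X =
      -(-D.closedLoop X F) - D.schur - Vᵀ * D.R * V := by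
    rw [neg_neg, sub_sub, ← cost_eq hD.posDef_R, closedLoop, add_sub_cancel_right]
  rw [hE, h2, Matrix.mul_smul, Matrix.trace_smul, smul_eq_mul, Matrix.sub_mul, Matrix.sub_mul,
    Matrix.neg_mul, Matrix.trace_sub, Matrix.trace_sub, Matrix.trace_neg] at h1
  have h3 := mul_nonneg hl (trace_mul_nonneg hX hS)
  have h4 := trace_mul_nonneg h hS
  have h5 := trace_mul_nonneg hD.posSemidef_schur hS
  have h6 := trace_mul_nonneg hVR hS
  have h7 := mul_eq_zero_of_trace_mul_eq_zero hD.posSemidef_schur hS (by linarith)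
  have h8 := mul_eq_zero_of_trace_mul_eq_zero hVR hS (by linarith)
  have hVS : V * S = 0 := by
    refine eq_zero_of_conj_eq_zero hD.posDef_R ?_
    rw [Matrix.transpose_mul, Matrix.mul_assoc, Matrix.mul_assoc, ← Matrix.mul_assoc D.R,
      ← Matrix.mul_assoc Vᵀ, ← Matrix.mul_assoc Vᵀ, h8, Matrix.mul_zero]
  have hSV : S * Vᵀ = 0 := by
    have := congrArg Matrix.transpose hVS
    rwa [Matrix.transpose_mul, hSs, Matrix.transpose_zero] at this
  have hA : D.A + D.B * F = (D.A - D.B * D.R⁻¹ * D.Lᵀ) + D.B * V := by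
    rw [hV, Matrix.mul_add, Matrix.mul_assoc]; abel
  have hA₀ : ∀ i, D.A₀ i + D.B₀ i * F = (D.A₀ i - D.B₀ i * D.R⁻¹ * D.Lᵀ) + D.B₀ i * V := by
    intro i
    rw [hV, Matrix.mul_add, Matrix.mul_assoc]; abel
  refine hS0 (hD.eq_zero_of_unobserved lam S hl hS h7 ?_)
  rw [← hE]
  have hl' : ∀ (T : Matrix (Fin n) (Fin n) ℝ) (U : Matrix (Fin n) (Fin m) ℝ),
      (T + U * V) * S = T * S := by
    intro T U
    rw [Matrix.add_mul, Matrix.mul_assoc, hVS, Matrix.mul_zero, add_zero]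
  have hr' : ∀ (T : Matrix (Fin n) (Fin n) ℝ) (U : Matrix (Fin n) (Fin m) ℝ),
      S * (T + U * V)ᵀ = S * Tᵀ := by
    intro T U
    rw [Matrix.transpose_add, Matrix.transpose_mul, Matrix.mul_add, ← Matrix.mul_assoc, hSV,
      Matrix.zero_mul, add_zero]
  simp only [lyapOp, hA, hA₀, hl', hr']
  congr 1
  refine Finset.sum_congr rfl fun i _ => ?_
  rw [Matrix.mul_assoc _ S (_ + _)ᵀ, hr', ← Matrix.mul_assoc]

/-! ### Solutions of the stochastic Riccati equation -/

lemma IsRegular.isStableLoop_gain (hD : D.IsRegular) {X : Matrix (Fin n) (Fin n) ℝ}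
    (hX : X.PosSemidef) (h : (-D.residual X).PosSemidef) : D.IsStableLoop (D.gain X) :=
  hD.isStableLoop hX (by rwa [closedLoop_gain hD.posDef_R hX])

/-- A positive semidefinite supersolution dominates every positive semidefinite subsolution. -/
lemma IsRegular.posSemidef_sub (hD : D.IsRegular) {X Y : Matrix (Fin n) (Fin n) ℝ}
    (hX : X.PosSemidef) (hY : Y.PosSemidef) (hXr : (D.residual X).PosSemidef)
    (hYr : (-D.residual Y).PosSemidef) : (Y - X).PosSemidef := by
  refine (hD.isStableLoop_gain hY hYr).posSemidef_sub (isSymm_of_posSemidef hX)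
    (isSymm_of_posSemidef hY) ?_
  rw [closedLoop_gain hD.posDef_R hY]
  convert ((posSemidef_closedLoop_sub_residual hD.posDef_R hX (D.gain Y)).add hXr).add hYr using 1
  abel

lemma IsRegular.isPSDSolution_unique (hD : D.IsRegular) {X Y : Matrix (Fin n) (Fin n) ℝ}
    (hX : D.IsPSDSolution X) (hY : D.IsPSDSolution Y) : X = Y := by
  have h0 : ∀ Z, D.IsPSDSolution Z → (D.residual Z).PosSemidef ∧ (-D.residual Z).PosSemidef := by
    intro Z hZ
    rw [hZ.2, neg_zero]
    exact ⟨Matrix.PosSemidef.zero, Matrix.PosSemidef.zero⟩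
  have h1 := hD.posSemidef_sub hX.1 hY.1 (h0 X hX).1 (h0 Y hY).2
  have h2 := hD.posSemidef_sub hY.1 hX.1 (h0 Y hY).1 (h0 X hX).2
  exact sub_eq_zero.1 (posSemidef_antisymm h2 (by rwa [neg_sub]))

lemma IsRegular.exists_value (hD : D.IsRegular) {F : Matrix (Fin m) (Fin n) ℝ}
    (hF : D.IsStableLoop F) :
    ∃ Y : Matrix (Fin n) (Fin n) ℝ, Y.PosSemidef ∧ D.closedLoop Y F = 0 := by
  have hc := hD.posSemidef_cost F
  obtain ⟨Y, hY, hYL⟩ := HasCertificate.exists_lyapOp_eq hF (W := -D.cost F)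
    (by rw [Matrix.transpose_neg, isSymm_of_posSemidef hc])
  refine ⟨Y, HasCertificate.posSemidef_of_lyapOp hF hY (by rwa [hYL, neg_neg]), ?_⟩
  rw [closedLoop, hYL, neg_add_cancel]

lemma posSemidef_neg_residual_of_closedLoop_eq_zero (hR : D.R.PosDef)
    {X : Matrix (Fin n) (Fin n) ℝ} (hX : X.PosSemidef) {F : Matrix (Fin m) (Fin n) ℝ}
    (h : D.closedLoop X F = 0) : (-D.residual X).PosSemidef := by
  simpa [h] using posSemidef_closedLoop_sub_residual hR hX F

variable (D) in
/-- The deterministic problem obtained by freezing the noise contributions at `W`. One step of the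
iteration from `W` solves its Riccati equation. -/
def frozen (W : Matrix (Fin n) (Fin n) ℝ) : Data n m 0 where
  A := D.A
  B := D.B
  Q := D.Qc W
  L := D.Lc W
  R := D.Rc W
  A₀ := fun _ => 0
  B₀ := fun _ => 0

lemma frozen_residual (W X : Matrix (Fin n) (Fin n) ℝ) :
    (D.frozen W).residual X = D.Aᵀ * X + X * D.A + D.Qc W
      - (X * D.B + D.Lc W) * (D.Rc W)⁻¹ * (X * D.B + D.Lc W)ᵀ := by
  simp [residual, frozen, Pi11, Pi12, Pi22]

lemma residual_eq_frozen (X : Matrix (Fin n) (Fin n) ℝ) :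
    D.residual X = (D.frozen X).residual X := by
  rw [frozen_residual, residual, Qc, Lc, Rc, ← add_assoc, ← add_assoc]

/-- Joint continuity of the frozen residual at a positive semidefinite freezing point. -/
lemma tendsto_frozen_residual (hR : D.R.PosDef) {ι : Type*} {l : Filter ι}
    {w x : ι → Matrix (Fin n) (Fin n) ℝ} {W X : Matrix (Fin n) (Fin n) ℝ} (hW : W.PosSemidef)
    (hw : Tendsto w l (𝓝 W)) (hx : Tendsto x l (𝓝 X)) :
    Tendsto (fun k => (D.frozen (w k)).residual (x k)) l (𝓝 ((D.frozen W).residual X)) := by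
  have hRc : Continuous D.Rc := by
    unfold Rc Pi22
    fun_prop
  have hinv : ContinuousAt (fun Y => (D.Rc Y)⁻¹) W := by
    refine ContinuousAt.comp (f := D.Rc) (g := fun S => S⁻¹) ?_ hRc.continuousAt
    refine continuousAt_matrix_inv _ ?_
    rw [Ring.inverse_eq_inv']
    exact continuousAt_inv₀ (posDef_Rc hR hW).det_pos.ne'
  let g : Matrix (Fin n) (Fin n) ℝ × Matrix (Fin n) (Fin n) ℝ × Matrix (Fin m) (Fin m) ℝ →
      Matrix (Fin n) (Fin n) ℝ := fun q =>
    D.Aᵀ * q.2.1 + q.2.1 * D.A + D.Qc q.1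
      - (q.2.1 * D.B + D.Lc q.1) * q.2.2 * (q.2.1 * D.B + D.Lc q.1)ᵀ
  have hg : Continuous g := by
    unfold g Qc Lc Pi11 Pi12
    fun_prop
  have h := (hg.tendsto (W, X, (D.Rc W)⁻¹)).comp
    (hw.prodMk_nhds (hx.prodMk_nhds (hinv.tendsto.comp hw)))
  simp_rw [frozen_residual]
  exact h

lemma continuousAt_residual (hR : D.R.PosDef) {X : Matrix (Fin n) (Fin n) ℝ}
    (hX : X.PosSemidef) : ContinuousAt D.residual X := by
  have h := tendsto_frozen_residual hR hX (tendsto_id (x := 𝓝 X)) tendsto_id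
  simp only [id, ← residual_eq_frozen] at h
  exact h

/-- Existence of a positive semidefinite solution: a supersolution of least trace solves the
equation, because a Newton step decreases supersolutions. -/
theorem IsRegular.exists_isPSDSolution (hD : D.IsRegular) : ∃ X, D.IsPSDSolution X := by
  have hR := hD.posDef_R
  obtain ⟨F, hF⟩ := hD.exists_isStableLoop
  obtain ⟨Y₀, hY₀, hY₀F⟩ := hD.exists_value hF
  have hcl : IsClosed ({X : Matrix (Fin n) (Fin n) ℝ | X.PosSemidef ∧ X.trace ≤ Y₀.trace} ∩
      (fun X => -D.residual X) ⁻¹' {Z | Z.PosSemidef}) :=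
    ContinuousOn.preimage_isClosed_of_isClosed
      (fun X hX => (continuousAt_residual hR hX.1).neg.continuousWithinAt)
      (isCompact_setOf_posSemidef_trace_le _).isClosed isClosed_setOf_posSemidef
  have hcp := (isCompact_setOf_posSemidef_trace_le Y₀.trace).of_isClosed_subset hcl
    Set.inter_subset_left
  obtain ⟨X, ⟨⟨hX, hXt⟩, hXr⟩, hmin⟩ := hcp.exists_isMinOn
    ⟨Y₀, ⟨hY₀, le_rfl⟩, posSemidef_neg_residual_of_closedLoop_eq_zero hR hY₀ hY₀F⟩
    continuous_id.matrix_trace.continuousOn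
  have hst := hD.isStableLoop_gain hX hXr
  obtain ⟨Y, hY, hYF⟩ := hD.exists_value hst
  have hle : (X - Y).PosSemidef := by
    refine hst.posSemidef_sub (isSymm_of_posSemidef hY) (isSymm_of_posSemidef hX) ?_
    rwa [hYF, closedLoop_gain hR hX, zero_sub]
  have ht := hle.trace_nonneg
  rw [Matrix.trace_sub] at ht
  have hm : X.trace ≤ Y.trace := hmin
    ⟨⟨hY, by linarith⟩, posSemidef_neg_residual_of_closedLoop_eq_zero hR hY hYF⟩
  have heq : X = Y := sub_eq_zero.1 (hle.trace_eq_zero_iff.1 (by rw [Matrix.trace_sub]; linarith))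
  refine ⟨X, hX, ?_⟩
  rw [← closedLoop_gain hR hX, ← hYF, ← heq]

end Theory

/-! ### Freezing the noise -/

section Iteration

variable {n m r : ℕ} {D : Data n m r}

lemma frozen_cost {W : Matrix (Fin n) (Fin n) ℝ} (hW : Wᵀ = W) (F : Matrix (Fin m) (Fin n) ℝ) :
    (D.frozen W).cost F =
      D.cost F + ∑ i, (D.A₀ i + D.B₀ i * F)ᵀ * W * (D.A₀ i + D.B₀ i * F) := by
  rw [sum_conj_add_mul hW]
  simp only [cost, frozen, Qc, Lc, Rc, Matrix.transpose_add, Matrix.add_mul, Matrix.mul_add]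
  abel

lemma frozen_closedLoop_sub {W W' : Matrix (Fin n) (Fin n) ℝ} (hW : Wᵀ = W) (hW' : W'ᵀ = W')
    (X : Matrix (Fin n) (Fin n) ℝ) (F : Matrix (Fin m) (Fin n) ℝ) :
    (D.frozen W).closedLoop X F - (D.frozen W').closedLoop X F =
      ∑ i, (D.A₀ i + D.B₀ i * F)ᵀ * (W - W') * (D.A₀ i + D.B₀ i * F) := by
  simp only [closedLoop, frozen_cost hW, frozen_cost hW', Matrix.mul_sub, Matrix.sub_mul,
    Finset.sum_sub_distrib]
  simp only [frozen, lyapOp]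
  abel

/-- The frozen residual is monotone in the freezing point, because a pointwise minimum over
feedbacks of monotone expressions is monotone. -/
lemma posSemidef_frozen_residual_sub (hR : D.R.PosDef) {W W' X : Matrix (Fin n) (Fin n) ℝ}
    (hW : W.PosSemidef) (hW' : W'.PosSemidef) (hX : X.PosSemidef) (h : (W - W').PosSemidef) :
    ((D.frozen W).residual X - (D.frozen W').residual X).PosSemidef := by
  have hRW : (D.frozen W).R.PosDef := posDef_Rc hR hW
  have hRW' : (D.frozen W').R.PosDef := posDef_Rc hR hW'
  rw [← closedLoop_gain hRW hX]
  have h1 := frozen_closedLoop_sub (D := D) (isSymm_of_posSemidef hW) (isSymm_of_posSemidef hW')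
    X ((D.frozen W).gain X)
  have h2 := Matrix.posSemidef_sum Finset.univ fun i _ =>
    posSemidef_conj h (D.A₀ i + D.B₀ i * (D.frozen W).gain X)
  rw [← h1] at h2
  convert h2.add (posSemidef_closedLoop_sub_residual hRW' hX ((D.frozen W).gain X)) using 1
  abel

lemma gain_frozen (W X : Matrix (Fin n) (Fin n) ℝ) :
    (D.frozen W).gain X = -((D.Rc W)⁻¹ * (X * D.B + D.Lc W)ᵀ) := by
  simp [gain, frozen, Rc, Lc, Pi12, Pi22]

lemma Ac_sub_Gc_mul {X : Matrix (Fin n) (Fin n) ℝ} (hX : Xᵀ = X)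
    (W : Matrix (Fin n) (Fin n) ℝ) :
    D.Ac W - D.Gc W * X = D.A + D.B * (D.frozen W).gain X := by
  rw [gain_frozen, Ac, Gc, Matrix.transpose_add, Matrix.transpose_mul, hX]
  simp only [Matrix.mul_neg, Matrix.mul_add, Matrix.mul_assoc]
  abel

lemma transpose_Gc (hR : D.R.PosDef) {W : Matrix (Fin n) (Fin n) ℝ} (hW : W.PosSemidef) :
    (D.Gc W)ᵀ = D.Gc W := by
  simp only [Gc, Matrix.transpose_mul, Matrix.transpose_transpose, Matrix.transpose_nonsing_inv,
    isSymm_of_posDef (posDef_Rc hR hW), Matrix.mul_assoc]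

/-- The weight of the frozen problem dominates that of the original one. -/
lemma exists_Hc_eq (hR : D.R.PosDef) {W : Matrix (Fin n) (Fin n) ℝ} (hW : W.PosSemidef) :
    ∃ T : Matrix (Fin n) (Fin n) ℝ, T.PosSemidef ∧ D.Hc W = D.schur + T := by
  have hRW : (D.frozen W).R.PosDef := posDef_Rc hR hW
  set F := -((D.Rc W)⁻¹ * (D.Lc W)ᵀ) with hF
  have h1 := cost_eq hRW F
  have h2 : F + (D.frozen W).R⁻¹ * (D.frozen W).Lᵀ = 0 := neg_add_cancel _
  rw [h2, frozen_cost (isSymm_of_posSemidef hW), cost_eq hR] at h1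
  refine ⟨_, (posSemidef_conj hR.posSemidef (F + D.R⁻¹ * D.Lᵀ)).add
    (Matrix.posSemidef_sum Finset.univ fun i _ => posSemidef_conj hW (D.A₀ i + D.B₀ i * F)), ?_⟩
  rw [← add_assoc, h1]
  simp [schur, frozen, Hc]

lemma riccati_eq_frozen_residual (hR : D.R.PosDef) {W X : Matrix (Fin n) (Fin n) ℝ}
    (hW : W.PosSemidef) (hX : Xᵀ = X) :
    (D.Ac W)ᵀ * X + X * D.Ac W - X * D.Gc W * X + D.Hc W = (D.frozen W).residual X := by
  rw [frozen_residual]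
  simp only [Ac, Gc, Hc, Matrix.transpose_sub, Matrix.transpose_add, Matrix.transpose_mul,
    Matrix.transpose_transpose, Matrix.transpose_nonsing_inv, hX,
    isSymm_of_posDef (posDef_Rc hR hW), Matrix.mul_add, Matrix.add_mul, Matrix.mul_sub,
    Matrix.sub_mul, Matrix.mul_assoc]
  abel

/-- Freezing the noise at a positive semidefinite matrix preserves the standing assumptions. On the
kernel of the frozen weight the matrices `Lᵀ` and `A₀ i` vanish, so the frozen drift acts there as
`A`, and deterministic detectability applies. -/
theorem isRegular_frozen (hR : D.R.PosDef) (hS : D.schur.PosSemidef)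
    (hker : ∀ z : Fin n → ℝ, D.schur *ᵥ z = 0 → D.Lᵀ *ᵥ z = 0 ∧ ∀ i, D.A₀ i *ᵥ z = 0)
    (hAB : IsStabilizable D.A D.B) (hQA : IsDetectable D.schur D.A)
    {W : Matrix (Fin n) (Fin n) ℝ} (hW : W.PosSemidef) : (D.frozen W).IsRegular := by
  obtain ⟨T, hT, hHT⟩ := exists_Hc_eq hR hW
  have hschur : (D.frozen W).schur = D.Hc W := rfl
  refine ⟨posDef_Rc hR hW, ?_, ?_, ?_⟩
  · rw [hschur, hHT]
    exact hS.add hT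
  · obtain ⟨F, hF⟩ := hAB
    exact ⟨F, (hF.hasCertificate fun i => (D.frozen W).A₀ i + (D.frozen W).B₀ i * F).transpose⟩
  · intro lam S hl hSp h0 hE
    have hSs := isSymm_of_posSemidef hSp
    have h1 : D.schur * S = 0 := by
      refine mul_eq_zero_of_trace_mul_eq_zero hS hSp ?_
      rw [hschur, hHT, Matrix.add_mul] at h0
      have h2 := congrArg Matrix.trace h0
      rw [Matrix.trace_add, Matrix.trace_zero] at h2
      have := trace_mul_nonneg hS hSp
      have := trace_mul_nonneg hT hSp
      linarith
    have hcol : ∀ v, D.Lᵀ *ᵥ (S *ᵥ v) = 0 ∧ ∀ i, D.A₀ i *ᵥ (S *ᵥ v) = 0 := fun v =>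
      hker _ (by rw [Matrix.mulVec_mulVec, h1, Matrix.zero_mulVec])
    have hL : D.Lᵀ * S = 0 := by
      refine Matrix.ext_of_mulVec_single fun i => ?_
      rw [← Matrix.mulVec_mulVec, (hcol _).1, Matrix.zero_mulVec]
    have hA₀ : ∀ i, D.A₀ i * S = 0 := by
      intro i
      refine Matrix.ext_of_mulVec_single fun j => ?_
      rw [← Matrix.mulVec_mulVec, (hcol _).2 i, Matrix.zero_mulVec]
    have hLc : (D.Lc W)ᵀ * S = 0 := by
      simp [Lc, Pi12, Matrix.transpose_sum, Matrix.sum_mul, Matrix.add_mul, hL, Matrix.mul_assoc,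
        hA₀]
    obtain ⟨K, hK⟩ := hQA
    have hdrift : (D.A - D.B * (D.Rc W)⁻¹ * (D.Lc W)ᵀ) * S = (D.A + K * D.schur) * S := by
      rw [Matrix.sub_mul, Matrix.add_mul, Matrix.mul_assoc _ (D.Lc W)ᵀ, hLc, Matrix.mul_assoc K, h1]
      simp
    have hdrift' : S * (D.A - D.B * (D.Rc W)⁻¹ * (D.Lc W)ᵀ)ᵀ = S * (D.A + K * D.schur)ᵀ := by
      have := congrArg Matrix.transpose hdrift
      rwa [Matrix.transpose_mul, Matrix.transpose_mul, hSs] at this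
    refine hK.sylvester hK.transpose hl ?_
    rw [← hE, ← hdrift, ← hdrift']
    simp [lyapOp, frozen]

/-! ### The iteration -/

lemma isStabilizingSolution_of_isPSDSolution (hR : D.R.PosDef) {W X : Matrix (Fin n) (Fin n) ℝ}
    (hW : W.PosSemidef) (hfr : (D.frozen W).IsRegular) (hX : (D.frozen W).IsPSDSolution X) :
    IsStabilizingSolution (D.Ac W) (D.Gc W) (D.Hc W) X := by
  have hXs := isSymm_of_posSemidef hX.1
  refine ⟨by rw [riccati_eq_frozen_residual hR hW hXs, hX.2], ?_⟩
  rw [Ac_sub_Gc_mul hXs]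
  refine HasCertificate.isStable (hfr.isStableLoop_gain hX.1 ?_)
  rw [hX.2, neg_zero]
  exact Matrix.PosSemidef.zero

lemma isStabilizingSolution_frozen_unique (hR : D.R.PosDef) (hS : D.schur.PosSemidef)
    {W X Y : Matrix (Fin n) (Fin n) ℝ} (hW : W.PosSemidef)
    (hX : IsStabilizingSolution (D.Ac W) (D.Gc W) (D.Hc W) X)
    (hY : IsStabilizingSolution (D.Ac W) (D.Gc W) (D.Hc W) Y) : X = Y := by
  obtain ⟨T, hT, hHT⟩ := exists_Hc_eq hR hW
  exact hX.unique (transpose_Gc hR hW)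
    (by rw [hHT]; exact isSymm_of_posSemidef (hS.add hT)) hY

/-- Stabilizing solutions, which are not assumed symmetric, are positive semidefinite: by uniqueness
they coincide with the positive semidefinite solution of the frozen problem. -/
lemma isPSDSolution_frozen_of_isStabilizingSolution (hR : D.R.PosDef) (hS : D.schur.PosSemidef)
    {W X : Matrix (Fin n) (Fin n) ℝ} (hW : W.PosSemidef) (hfr : (D.frozen W).IsRegular)
    (hX : IsStabilizingSolution (D.Ac W) (D.Gc W) (D.Hc W) X) :
    (D.frozen W).IsPSDSolution X := by
  obtain ⟨Z, hZ⟩ := hfr.exists_isPSDSolution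
  rwa [isStabilizingSolution_frozen_unique hR hS hW hX
    (isStabilizingSolution_of_isPSDSolution hR hW hfr hZ)]

lemma existsUnique_isFPSDA (hR : D.R.PosDef) (hS : D.schur.PosSemidef)
    (hfr : ∀ W : Matrix (Fin n) (Fin n) ℝ, W.PosSemidef → (D.frozen W).IsRegular)
    {X₀ : Matrix (Fin n) (Fin n) ℝ} (hX₀ : X₀.PosSemidef) :
    ∃! X : ℕ → Matrix (Fin n) (Fin n) ℝ, IsFPSDA D X₀ X := by
  have hex : ∀ W : {W : Matrix (Fin n) (Fin n) ℝ // W.PosSemidef},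
      ∃ Z : {Z : Matrix (Fin n) (Fin n) ℝ // Z.PosSemidef},
        IsStabilizingSolution (D.Ac W) (D.Gc W) (D.Hc W) Z := by
    rintro ⟨W, hW⟩
    obtain ⟨Z, hZ⟩ := (hfr W hW).exists_isPSDSolution
    exact ⟨⟨Z, hZ.1⟩, isStabilizingSolution_of_isPSDSolution hR hW (hfr W hW) hZ⟩
  choose φ hφ using hex
  refine ⟨fun k => (φ^[k] ⟨X₀, hX₀⟩ : {Z : Matrix (Fin n) (Fin n) ℝ // Z.PosSemidef}),
    ⟨rfl, fun k => ?_⟩, fun Y hY => funext fun k => ?_⟩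
  · simp only [Function.iterate_succ_apply']
    exact hφ _
  · induction k with
    | zero => exact hY.1
    | succ k ih =>
      have h1 := hY.2 k
      rw [ih] at h1
      rw [Function.iterate_succ_apply']
      exact isStabilizingSolution_frozen_unique hR hS (φ^[k] ⟨X₀, hX₀⟩).2 h1 (hφ _)

/-- One step of the iteration from a supersolution `W` decreases, stays above the subsolution `Xs`,
and leads to a supersolution. -/
lemma step_invariant (hR : D.R.PosDef) {W Z Xs : Matrix (Fin n) (Fin n) ℝ}
    (hW : W.PosSemidef) (hfr : (D.frozen W).IsRegular) (hZ : (D.frozen W).IsPSDSolution Z)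
    (hXs : D.IsPSDSolution Xs) (hWXs : (W - Xs).PosSemidef)
    (hWr : (-D.residual W).PosSemidef) :
    (W - Z).PosSemidef ∧ (Z - Xs).PosSemidef ∧ (-D.residual Z).PosSemidef := by
  have h0 : ((D.frozen W).residual Z).PosSemidef ∧ (-(D.frozen W).residual Z).PosSemidef := by
    rw [hZ.2, neg_zero]
    exact ⟨Matrix.PosSemidef.zero, Matrix.PosSemidef.zero⟩
  have hWZ : (W - Z).PosSemidef :=
    hfr.posSemidef_sub hZ.1 hW h0.1 (by rwa [← residual_eq_frozen])
  refine ⟨hWZ, hfr.posSemidef_sub hXs.1 hZ.1 ?_ h0.2, ?_⟩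
  · have := posSemidef_frozen_residual_sub hR hW hXs.1 hXs.1 hWXs
    rwa [← residual_eq_frozen Xs, hXs.2, sub_zero] at this
  · have := posSemidef_frozen_residual_sub hR hW hZ.1 hZ.1 hWZ
    rwa [← residual_eq_frozen Z, hZ.2, zero_sub] at this

end Iteration

end Data

/-- Monotone convergence for symmetric matrices: quadratic forms converge, and entries are recovered
by polarization. -/
lemma exists_tendsto_of_antitone {n : ℕ} {X : ℕ → Matrix (Fin n) (Fin n) ℝ}
    (hX : ∀ k, (X k).PosSemidef) (hanti : ∀ k, (X k - X (k + 1)).PosSemidef) :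
    ∃ L, Tendsto X atTop (𝓝 L) := by
  have hquad : ∀ v : Fin n → ℝ, ∃ l, Tendsto (fun k => v ⬝ᵥ (X k *ᵥ v)) atTop (𝓝 l) := by
    intro v
    refine ⟨_, tendsto_atTop_ciInf (antitone_nat_of_succ_le fun k => ?_) ⟨0, ?_⟩⟩
    · have := (posSemidef_iff_real.1 (hanti k)).2 v
      rw [Matrix.sub_mulVec, dotProduct_sub] at this
      linarith
    · rintro - ⟨k, rfl⟩
      exact (posSemidef_iff_real.1 (hX k)).2 v
  choose q hq using hquad
  refine ⟨fun i j => (q (Pi.single i 1 + Pi.single j 1) - q (Pi.single i 1)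
    - q (Pi.single j 1)) / 2, tendsto_pi_nhds.2 fun i => tendsto_pi_nhds.2 fun j => ?_⟩
  refine ((((hq _).sub (hq _)).sub (hq _)).div_const 2).congr fun k => ?_
  have e : ∀ a b, Pi.single (M := fun _ => ℝ) a 1 ⬝ᵥ (X k *ᵥ Pi.single b 1) = X k a b := by
    intro a b
    simp
  have hji : X k j i = X k i j := congrFun (congrFun (isSymm_of_posSemidef (hX k)) i) j
  simp only [Matrix.mulVec_add, add_dotProduct, dotProduct_add, e, hji]
  ring

end SCARE

open SCARE SCARE.Data

theorem mainTheorem2 {n m r p : ℕ} (D : SCARE.Data n m r)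
    (hR : D.R.PosDef)
    (hQLR : (Matrix.fromBlocks D.Q D.L D.Lᵀ D.R).PosSemidef)
    (C : Matrix (Fin p) (Fin n) ℝ)
    (hC : Cᵀ * C = D.Q - D.L * D.R⁻¹ * D.Lᵀ)
    (hstab : D.StochStabilizable)
    (hdet : D.StochDetectable C)
    (hker : ∀ z : Fin n → ℝ, (D.Q - D.L * D.R⁻¹ * D.Lᵀ) *ᵥ z = 0 →
      D.Lᵀ *ᵥ z = 0 ∧ ∀ i, D.A₀ i *ᵥ z = 0)
    (hAB : SCARE.IsStabilizable D.A D.B)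
    (hQA : SCARE.IsDetectable (D.Q - D.L * D.R⁻¹ * D.Lᵀ) D.A) :
    (∃! Xs : Matrix (Fin n) (Fin n) ℝ, D.IsPSDSolution Xs) ∧
    ∀ Xs : Matrix (Fin n) (Fin n) ℝ, D.IsPSDSolution Xs →
      ∀ X₀ : Matrix (Fin n) (Fin n) ℝ,
        (X₀ - Xs).PosSemidef →
        SCARE.IsStable (D.Ac X₀ - D.Gc X₀ * X₀) →
        (-(D.residual X₀)).PosSemidef →
        (∃! X : ℕ → Matrix (Fin n) (Fin n) ℝ, SCARE.IsFPSDA D X₀ X) ∧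
        ∀ X : ℕ → Matrix (Fin n) (Fin n) ℝ, SCARE.IsFPSDA D X₀ X →
          (∀ k, (X k - X (k + 1)).PosSemidef ∧ (X k - Xs).PosSemidef ∧
            (-(D.residual (X k))).PosSemidef) ∧
          Tendsto X atTop (𝓝 Xs) := by
  -- the Schur complement is the Gram matrix `Cᵀ C`
  have hS : D.schur.PosSemidef := by
    have := Matrix.posSemidef_conjTranspose_mul_self C
    rwa [Matrix.conjTranspose_eq_transpose_of_trivial, hC] at this
  have hD : D.IsRegular := by
    refine ⟨hR, hS, ?_, ?_⟩
    · obtain ⟨F, hF⟩ := hstab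
      exact ⟨F, hF.hasCertificate.transpose⟩
    · intro lam S hl hSp h0 hE
      have hSs := isSymm_of_posSemidef hSp
      have hCS : C * S = 0 := by
        rw [← Matrix.trace_conjTranspose_mul_self_eq_zero_iff (R := ℝ),
          Matrix.conjTranspose_eq_transpose_of_trivial, Matrix.transpose_mul, Matrix.mul_assoc,
          ← Matrix.mul_assoc Cᵀ, hC]
        change (Sᵀ * (D.schur * S)).trace = 0
        rw [h0, Matrix.mul_zero, Matrix.trace_zero]
      have hSC : S * Cᵀ = 0 := by
        have := congrArg Matrix.transpose hCS
        rwa [Matrix.transpose_mul, hSs, Matrix.transpose_zero] at this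
      obtain ⟨K, hK⟩ := hdet
      refine hK.hasCertificate.no_eigenvector hl hSs ?_
      rw [← hE, lyapOp, lyapOp, Matrix.add_mul, Matrix.mul_assoc K, hCS, Matrix.mul_zero, add_zero,
        Matrix.transpose_add, Matrix.transpose_mul, Matrix.mul_add, ← Matrix.mul_assoc S, hSC,
        Matrix.zero_mul, add_zero]
  have hfr : ∀ W : Matrix (Fin n) (Fin n) ℝ, W.PosSemidef → (D.frozen W).IsRegular :=
    fun W hW => isRegular_frozen hR hS hker hAB hQA hW
  obtain ⟨Z, hZ⟩ := hD.exists_isPSDSolution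
  refine ⟨⟨Z, hZ, fun Y hY => hD.isPSDSolution_unique hY hZ⟩, ?_⟩
  intro Xs hXs X₀ hX₀ _ hX₀r
  have hge : ∀ W : Matrix (Fin n) (Fin n) ℝ, (W - Xs).PosSemidef → W.PosSemidef := by
    intro W hW
    simpa using hW.add hXs.1
  refine ⟨existsUnique_isFPSDA hR hS hfr (hge X₀ hX₀), ?_⟩
  rintro X ⟨h0, hstep⟩
  have hsol : ∀ k, (X k).PosSemidef → (D.frozen (X k)).IsPSDSolution (X (k + 1)) := fun k hk =>
    isPSDSolution_frozen_of_isStabilizingSolution hR hS hk (hfr _ hk) (hstep k)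
  have hinv : ∀ k, (X k - Xs).PosSemidef ∧ (-(D.residual (X k))).PosSemidef := by
    intro k
    induction k with
    | zero => rw [h0]; exact ⟨hX₀, hX₀r⟩
    | succ k ih =>
      have hk := hge _ ih.1
      exact (step_invariant hR hk (hfr _ hk) (hsol k hk) hXs ih.1 ih.2).2
  have hpsd : ∀ k, (X k).PosSemidef := fun k => hge _ (hinv k).1
  have hanti : ∀ k, (X k - X (k + 1)).PosSemidef := fun k =>
    (step_invariant hR (hpsd k) (hfr _ (hpsd k)) (hsol k (hpsd k)) hXs (hinv k).1 (hinv k).2).1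
  refine ⟨fun k => ⟨hanti k, hinv k⟩, ?_⟩
  obtain ⟨Y, hY⟩ := exists_tendsto_of_antitone hpsd hanti
  have hYp : Y.PosSemidef :=
    isClosed_setOf_posSemidef.mem_of_tendsto hY (Eventually.of_forall hpsd)
  have hlim := tendsto_frozen_residual hR hYp hY ((tendsto_add_atTop_iff_nat 1).2 hY)
  simp only [(hsol _ (hpsd _)).2] at hlim
  have hYr : D.residual Y = 0 := by
    rw [residual_eq_frozen]
    exact tendsto_nhds_unique hlim tendsto_const_nhds
  rwa [hD.isPSDSolution_unique hXs ⟨hYp, hYr⟩]
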